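/- Let $L\ge 2$. For a nonempty finite set $M$ of $m$ candidates, identified with $\{0,\dots,m-1\}$, an up-to-$L$ vote is a strict ranking of $i$ distinct candidates of $M$ with $1\le i\le L$ (the remaining candidates being tied below them), a profile is a finite sequence of such votes, and an up-to-$L$ voting rule $\overline r_L$ assigns to every such $M$ and every profile over $M$ a unique winner in $M$. It is anonymous if the winner does not change when the votes of a profile are permuted. The problem WAV-$\overline r_L$ (winner with absent votes) asks, given $M$, a profile $P$ of known votes, a number $t\ge 0$ of absent votes and a candidate $c\in M$, whether there is a profile $P'$ of $t$ up-to-$L$ votes such that $\overline r_L(P\cup P')=c$, where $P\cup P'$ is the concatenation of the two profiles. Inputs are encoded so that $M$ and $t$ contribute $m$ and $t$ symbols (that is, $m$ and $t$ are written in unary) and profiles are listed vote by vote. Let $\overline r_L$ be an anonymous up-to-$L$ voting rule whose winner can be computed in polynomial time, given $M$ and a profile over $M$. Then 1. for every fixed $m\ge 2$, the problem WAV-$\overline r_L$ restricted to instances with exactly $m$ candidates (where $m$ is a constant and not part of the input) can be solved in polynomial time; 2. for every fixed $t\ge 0$, the problem WAV-$\overline r_L$ restricted to instances with exactly $t$ absent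 votes (where $t$ is a constant and not part of the input) can be solved in polynomial time. -/

import Mathlib

namespace UpToL

open Turing Computability

/-- A vote in the up-to-`L` setting over the candidates `Fin m`: a strict ranking of `i` distinct
candidates, best first, with `1 ≤ i ≤ L`; the unranked candidates are tied below the ranked ones. -/
@[ext]
structure Ballot (m L : ℕ) where
  ranking : List (Fin m)
  nodup : ranking.Nodup
  one_le_length : 1 ≤ ranking.length
  length_le : ranking.length ≤ L

/-- A profile is a finite sequence of votes, one for each voter. -/
abbrev Profile (m L : ℕ) : Type := List (Ballot m L)

/-- A resolute up-to-`L` voting rule: for every nonempty finite set of candidates, it maps every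
profile to a unique winner. -/
def VotingRule (L : ℕ) : Type := ∀ m : ℕ, 0 < m → Profile m L → Fin m

/-- The winner does not depend on which voter cast which vote. -/
def VotingRule.Anonymous {L : ℕ} (r : VotingRule L) : Prop :=
  ∀ (m : ℕ) (hm : 0 < m) (P Q : Profile m L), P.Perm Q → r m hm P = r m hm Q

/-- An input of the winner determination problem: a nonempty set of candidates and a profile. -/
structure Election (L : ℕ) where
  m : ℕ
  pos : 0 < m
  votes : Profile m L

/-- The number of the winning candidate. -/
def VotingRule.winner {L : ℕ} (r : VotingRule L) (E : Election L) : ℕ :=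
  (r E.m E.pos E.votes : ℕ)

/-- An input of the problem WAV (winner with absent votes). -/
structure WAVInstance (L : ℕ) where
  /-- the number of candidates -/
  m : ℕ
  /-- the profile of known votes -/
  known : Profile m L
  /-- the number of absent votes -/
  absent : ℕ
  /-- the targeted candidate -/
  target : Fin m

/-- The question of WAV: is there a profile of absent votes, of the prescribed size, that makes the
targeted candidate the winner? -/
def VotingRule.WAV {L : ℕ} (r : VotingRule L) (I : WAVInstance L) : Prop :=
  ∃ P' : Profile I.m L, P'.length = I.absent ∧
    r I.m I.target.pos (I.known ++ P') = I.target

/-! ### Encodings as strings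

The set of candidates and the number of absent votes contribute `m` and `t` symbols to the input,
and the profile is written vote by vote. Since the set of candidates takes up `m` symbols anyway,
writing a candidate as a tally instead of in binary changes lengths only polynomially. -/

/-- A natural number as a tally, closed by a comma. -/
def encodeTally (k : ℕ) : List Γ' := List.replicate k (Γ'.bit true) ++ [Γ'.comma]

/-- A vote: the ranked candidates in order, between brackets. -/
def encodeBallot {m L : ℕ} (v : Ballot m L) : List Γ' :=
  Γ'.bra :: v.ranking.flatMap (fun c : Fin m => encodeTally c.val) ++ [Γ'.ket]

def encodeProfile {m L : ℕ} (P : Profile m L) : List Γ' := P.flatMap encodeBallot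

def encodeElection {L : ℕ} (E : Election L) : List Γ' :=
  encodeTally E.m ++ encodeProfile E.votes

/-- Inputs of WAV with a fixed number `m` of candidates; `m` is not part of the input string. -/
def encodeFixedM {L m : ℕ} (I : {I : WAVInstance L // I.m = m}) : List Γ' :=
  encodeTally I.1.absent ++ encodeTally (I.1.target : ℕ) ++ encodeProfile I.1.known

/-- Inputs of WAV with a fixed number `t` of absent votes; `t` is not part of the input string. -/
def encodeFixedT {L t : ℕ} (I : {I : WAVInstance L // I.absent = t}) : List Γ' :=
  encodeTally I.1.m ++ encodeTally (I.1.target : ℕ) ++ encodeProfile I.1.known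

/-! ### Polynomial time -/

/-- Some Turing machine decides, for every input `a`, whether `p a` holds, in a number of steps
that is at most a polynomial in the length of the string that encodes `a`. -/
def PolyTimeDecidable {α Γ : Type} (enc : α → List Γ) (p : α → Prop) : Prop :=
  ∃ f : α → Bool, (∀ a, f a = true ↔ p a) ∧
    Nonempty (TM2ComputableInPolyTime enc encodeBool f)

/-- The winner can be computed in polynomial time from the candidates and the profile. -/
def VotingRule.PolyTime {L : ℕ} (r : VotingRule L) : Prop :=
  Nonempty (TM2ComputableInPolyTime (encodeElection (L := L)) encodeTally r.winner)

end UpToL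

/-!
Both problems are solved by exhaustive search: the winner machine is called on the known votes
followed by each of polynomially many profiles of absent votes.

* For fixed `m` there are constantly many ballots, and by anonymity only the multiplicities of the
  ballots among the absent votes matter; these are boundedly many counters with values up to `t`.
* For fixed `t` the absent votes are described by `t * L` candidates, with repetitions for the votes
  that rank fewer than `L` of them.

In both cases the search is a nest of constantly many loops. It is written in a small language of
structured stack programs with calls to the winner machine, and these programs are compiled, step
for step, to multi-stack machines.
-/

namespace StackProg

open Turing Computability Function

/-- Programs over stacks indexed by `ι`. Conditions inspect the top symbol of a stack; `call i o`
runs a fixed machine on the reversal of stack `i` and puts the output, reversed, on stack `o`. -/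
inductive Prog (ι : Type) : Type
  | skip : Prog ι
  | push (k : ι) (a : Γ') : Prog ι
  | pop (k : ι) : Prog ι
  | copyTop (k k' : ι) : Prog ι
  | seq (p q : Prog ι) : Prog ι
  | ite (k : ι) (c : Option Γ' → Bool) (p q : Prog ι) : Prog ι
  | while (k : ι) (c : Option Γ' → Bool) (p : Prog ι) : Prog ι
  | call (i o : ι) : Prog ι

/-- The contents of the stacks of a program, top first. -/
abbrev Store (ι : Type) : Type := ι → List Γ'

variable {ι : Type}

/-- The symbol of which tallies consist. -/
abbrev one : Γ' := Γ'.bit true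

/-- `Steps f n c c'`: iterating `f` from `c` does not halt before the `n`-th step, which leads to
`c'`. -/
def Steps {C : Type} (f : C → Option C) (n : ℕ) (c c' : C) : Prop :=
  (flip bind f)^[n] (some c) = some c'

theorem Steps.single {C : Type} {f : C → Option C} {c c' : C} (h : f c = some c') :
    Steps f 1 c c' := h

theorem Steps.trans {C : Type} {f : C → Option C} {n n' : ℕ} {c c' c'' : C}
    (h : Steps f n c c') (h' : Steps f n' c' c'') : Steps f (n + n') c c'' := by
  unfold Steps at *
  rw [add_comm, iterate_add_apply, h, h']

theorem Steps.exists_of_succ {C : Type} {f : C → Option C} {n : ℕ} {c c'' : C}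
    (h : Steps f (n + 1) c c'') : ∃ c', Steps f n c c' ∧ f c' = some c'' := by
  unfold Steps at *
  rw [iterate_succ_apply'] at h
  exact Option.bind_eq_some_iff.mp h

/-- The machine `O` turns the input `w` into the output `u` in exactly `n` steps. -/
def Answers (O : TM2ComputableAux Γ' Γ') (w u : List Γ') (n : ℕ) : Prop :=
  Steps O.tm.step n (initList O.tm (w.map O.inputAlphabet.invFun))
    (haltList O.tm (u.map O.outputAlphabet.invFun))

/-- `Exec O p S n S'`: the program `p` takes the store `S` to the store `S'` in `n` steps, when
calls are answered by the machine `O`. -/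
inductive Exec [DecidableEq ι] (O : TM2ComputableAux Γ' Γ') : Prog ι → Store ι → ℕ → Store ι → Prop
  | skip (S) : Exec O .skip S 1 S
  | push (k a S) : Exec O (.push k a) S 1 (update S k (a :: S k))
  | pop (k S) : Exec O (.pop k) S 1 (update S k (S k).tail)
  | copyTop (k k' S a l) (h : S k = a :: l) :
      Exec O (.copyTop k k') S 1 (update S k' (a :: S k'))
  | seq {p q S n S' n' S''} (h : Exec O p S n S') (h' : Exec O q S' n' S'') :
      Exec O (.seq p q) S (n + n') S''
  | ite_true {k c p q S n S'} (hc : c (S k).head? = true) (h : Exec O p S n S') :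
      Exec O (.ite k c p q) S (1 + n) S'
  | ite_false {k c p q S n S'} (hc : c (S k).head? = false) (h : Exec O q S n S') :
      Exec O (.ite k c p q) S (1 + n) S'
  | while_true {k c p S n S' n' S''} (hc : c (S k).head? = true) (h : Exec O p S n S')
      (h' : Exec O (.while k c p) S' n' S'') : Exec O (.while k c p) S (1 + n + n') S''
  | while_false {k c p S} (hc : c (S k).head? = false) : Exec O (.while k c p) S 1 S
  | call {i o S w u n} (hi : S i = w.reverse) (h : Answers O w u n) :
      Exec O (.call i o) S (w.length + 1 + n + (u.length + 1))
        (update (update S i []) o (u.reverse ++ update S i [] o))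

/-- The program `p` takes `S` to `S'` in at most `T` steps. -/
def RunsIn [DecidableEq ι] (O : TM2ComputableAux Γ' Γ') (p : Prog ι) (S S' : Store ι)
    (T : ℕ) : Prop :=
  ∃ n ≤ T, Exec O p S n S'

section Compile

/-- The stacks of a compiled machine: one for its answer, the stacks `ι` of the program, and the
stacks `K` of the called machine. -/
inductive Stack (ι K : Type) : Type
  | answer
  | main (k : ι)
  | oracle (k : K)
  deriving DecidableEq, Fintype

/-- The labels of the code of a call: copy the input, run the called machine, copy the output. -/
inductive CallLabel (Λ : Type) : Type
  | load
  | run (l : Λ)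
  | unload
  deriving Fintype

variable (O : TM2ComputableAux Γ' Γ') {Λ : Type}

/-- The stack alphabets of the compiled machine. -/
@[reducible] def Alphabet : Stack ι O.tm.K → Type
  | .answer => Bool
  | .main _ => Γ'
  | .oracle k => O.tm.Γ k

/-- The internal states of the compiled machine: a register and a state of the called machine. -/
abbrev Register : Type := Option Γ' × O.tm.σ

/-- The statements of the compiled machine. -/
abbrev CompiledStmt (ι Λ : Type) : Type := TM2.Stmt (Alphabet (ι := ι) O) Λ (Register O)

/-- The labels of a compiled program. -/
def Label : Prog ι → Type
  | .skip => Unit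
  | .push _ _ => Unit
  | .pop _ => Unit
  | .copyTop _ _ => Unit
  | .seq p q => Label p ⊕ Label q
  | .ite _ _ p q => Option (Label p ⊕ Label q)
  | .while _ _ p => Option (Label p)
  | .call _ _ => CallLabel O.tm.Λ

instance (p : Prog ι) : Finite (Label O p) := by
  let := O.tm.ΛFin
  induction p <;> unfold Label <;> infer_instance

/-- The label at which the execution of a program starts. -/
def entry : (p : Prog ι) → Label O p
  | .skip => ()
  | .push _ _ => ()
  | .pop _ => ()
  | .copyTop _ _ => ()
  | .seq p _ => .inl (entry p)
  | .ite _ _ _ _ => none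
  | .while _ _ _ => none
  | .call _ _ => CallLabel.load

variable {O}

/-- A statement of the called machine as a statement of the compiled machine. -/
def liftStmt (e : O.tm.Λ → Λ) (exit : Λ) :
    TM2.Stmt O.tm.Γ O.tm.Λ O.tm.σ → CompiledStmt O ι Λ
  | .push k f q => .push (.oracle k) (fun s => f s.2) (liftStmt e exit q)
  | .peek k f q => .peek (.oracle k) (fun s a => (s.1, f s.2 a)) (liftStmt e exit q)
  | .pop k f q => .pop (.oracle k) (fun s a => (s.1, f s.2 a)) (liftStmt e exit q)
  | .load f q => .load (fun s => (s.1, f s.2)) (liftStmt e exit q)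
  | .branch f q q' => .branch (fun s => f s.2) (liftStmt e exit q) (liftStmt e exit q')
  | .goto f => .goto (fun s => e (f s.2))
  | .halt => .goto (fun _ => exit)

/-- Clear the register and jump. -/
def jump (l : Λ) : CompiledStmt O ι Λ :=
  .load (fun s => (none, s.2)) (.goto fun _ => l)

/-- Jump according to the top symbol of a program stack. -/
def test (k : ι) (c : Option Γ' → Bool) (l₁ l₂ : Λ) : CompiledStmt O ι Λ :=
  .peek (.main k) (fun s a => (a, s.2)) (.branch (fun s => c s.1) (jump l₁) (jump l₂))

/-- Move the top symbol of the program stack `i` to the input stack of the called machine and jump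
to `next`, or jump to `done` if there is none. -/
def loadStmt (i : ι) (next done : Λ) : CompiledStmt O ι Λ :=
  .pop (.main i) (fun s a => (a, s.2)) (.branch (fun s => s.1.isSome)
    (.push (.oracle O.tm.k₀) (fun s => O.inputAlphabet.invFun (s.1.getD default)) (jump next))
    (jump done))

/-- Move the top symbol of the output stack of the called machine to the program stack `o` and jump
to `next`, or jump to `done` if there is none. -/
def unloadStmt (o : ι) (next done : Λ) : CompiledStmt O ι Λ :=
  .pop (.oracle O.tm.k₁) (fun s a => (a.map O.outputAlphabet, s.2)) (.branch (fun s => s.1.isSome)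
    (.push (.main o) (fun s => (s.1.getD default : Γ')) (jump next))
    (jump done))

/-- Answer whether the program stack `flag` is nonempty, and halt. -/
def answerStmt (flag : ι) : CompiledStmt O ι Λ :=
  .pop (.main flag) (fun s a => (a, s.2))
    (.push .answer (fun s => s.1.isSome) (.load (fun s => (none, s.2)) .halt))

/-- The code of a program whose labels are placed by `e` and which continues at `exit`. -/
def code : (p : Prog ι) → (Label O p → Λ) → Λ → Label O p → CompiledStmt O ι Λ
  | .skip, _, exit, _ => jump exit
  | .push k a, _, exit, _ => .push (.main k) (fun _ => a) (jump exit)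
  | .pop k, _, exit, _ => .pop (.main k) (fun s _ => s) (jump exit)
  | .copyTop k k', _, exit, _ =>
    .peek (.main k) (fun s a => (a, s.2))
      (.push (.main k') (fun s => (s.1.getD default : Γ')) (jump exit))
  | .seq p q, e, exit, l =>
    Sum.elim (code p (fun l => e (.inl l)) (e (.inr (entry O q))))
      (code q (fun l => e (.inr l)) exit) l
  | .ite k c p q, e, exit, l =>
    Option.elim l (test k c (e (some (.inl (entry O p)))) (e (some (.inr (entry O q)))))
      (Sum.elim (code p (fun l => e (some (.inl l))) exit)
        (code q (fun l => e (some (.inr l))) exit))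
  | .while k c p, e, exit, l =>
    Option.elim l (test k c (e (some (entry O p))) exit) (code p (fun l => e (some l)) (e none))
  | .call i o, e, exit, l =>
    match (l : CallLabel O.tm.Λ) with
    | .load => loadStmt i (e CallLabel.load) (e (CallLabel.run O.tm.main))
    | .run l => liftStmt (fun l => e (CallLabel.run l)) (e CallLabel.unload) (O.tm.m l)
    | .unload => unloadStmt o (e CallLabel.unload) exit

/-- The contents of all stacks of the compiled machine. -/
def glue (b : List Bool) (S : Store ι) (T : ∀ k, List (O.tm.Γ k)) :
    ∀ k : Stack ι O.tm.K, List (Alphabet O k)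
  | .answer => b
  | .main k => S k
  | .oracle k => T k

@[simp] theorem glue_answer (b : List Bool) (S : Store ι) (T : ∀ k, List (O.tm.Γ k)) :
    glue b S T .answer = b := rfl

@[simp] theorem glue_main (b : List Bool) (S : Store ι) (T : ∀ k, List (O.tm.Γ k)) (k : ι) :
    glue b S T (.main k) = S k := rfl

@[simp] theorem glue_oracle (b : List Bool) (S : Store ι) (T : ∀ k, List (O.tm.Γ k))
    (k : O.tm.K) : glue b S T (.oracle k) = T k := rfl

theorem glue_nil : glue (O := O) [] (fun _ : ι => []) (fun _ => []) = fun _ => [] := by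
  funext k
  cases k <;> rfl

variable [DecidableEq ι]

@[simp] theorem update_glue_answer (b b' : List Bool) (S : Store ι) (T : ∀ k, List (O.tm.Γ k)) :
    update (glue b S T) .answer b' = glue b' S T := by
  funext j
  cases j <;> rfl

@[simp] theorem update_glue_main (b : List Bool) (S : Store ι) (T : ∀ k, List (O.tm.Γ k)) (k : ι)
    (x : List Γ') : update (glue b S T) (.main k) x = glue b (update S k x) T := by
  funext j
  rcases j with _ | j | j
  · rfl
  · obtain rfl | h := eq_or_ne j k <;> simp [*]
  · rfl

@[simp] theorem update_glue_oracle (b : List Bool) (S : Store ι) (T : ∀ k, List (O.tm.Γ k))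
    (k : O.tm.K) (x : List (O.tm.Γ k)) :
    update (glue b S T) (.oracle k) x = glue b S (update T k x) := by
  funext j
  rcases j with _ | j | j
  · rfl
  · rfl
  · obtain rfl | h := eq_or_ne j k <;> simp [*]

/-- The configuration of the compiled machine in which the called machine is idle. -/
def idleCfg (l : Λ) (S : Store ι) : TM2.Cfg (Alphabet (ι := ι) O) Λ (Register O) :=
  ⟨some l, (none, O.tm.initialState), glue [] S fun _ => []⟩

/-- A configuration of the called machine as one of the compiled machine; `exit` is the label to
continue at when the called machine has halted. -/
def liftCfg (e : O.tm.Λ → Λ) (exit : Λ) (S : Store ι) (c : O.tm.Cfg) :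
    TM2.Cfg (Alphabet (ι := ι) O) Λ (Register O) :=
  ⟨some (c.l.elim exit e), (none, c.var), glue [] S c.stk⟩

theorem stepAux_liftStmt (e : O.tm.Λ → Λ) (exit : Λ) (S : Store ι)
    (q : TM2.Stmt O.tm.Γ O.tm.Λ O.tm.σ) (v : O.tm.σ) (T : ∀ k, List (O.tm.Γ k)) :
    TM2.stepAux (liftStmt e exit q) (none, v) (glue [] S T) =
      liftCfg e exit S (TM2.stepAux q v T) := by
  induction q generalizing v T with
  | push k f q ih => simp only [liftStmt, TM2.stepAux, update_glue_oracle, glue_oracle, ih]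
  | peek k f q ih => simp only [liftStmt, TM2.stepAux, glue_oracle, ih]
  | pop k f q ih => simp only [liftStmt, TM2.stepAux, update_glue_oracle, glue_oracle, ih]
  | load f q ih => simp only [liftStmt, TM2.stepAux, ih]
  | branch f q q' ih ih' =>
    simp only [liftStmt, TM2.stepAux, ih, ih']
    cases f v <;> rfl
  | goto f => rfl
  | halt => rfl

variable {M : Λ → CompiledStmt O ι Λ}

theorem steps_liftCfg {e : O.tm.Λ → Λ} {exit : Λ} (S : Store ι)
    (hM : ∀ l, M (e l) = liftStmt e exit (O.tm.m l)) {n : ℕ} {c c' : O.tm.Cfg}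
    (h : Steps O.tm.step n c c') :
    Steps (TM2.step M) n (liftCfg e exit S c) (liftCfg e exit S c') := by
  induction n generalizing c' with
  | zero => cases h; rfl
  | succ n ih =>
    obtain ⟨⟨_ | l, v, T⟩, h, hd⟩ := h.exists_of_succ
    · cases hd
    · refine (ih h).trans (.single ?_)
      cases hd
      exact congrArg some ((congrArg (TM2.stepAux · _ _) (hM l)).trans
        (stepAux_liftStmt e exit S _ v T))

theorem step_jump {l l' : Λ} {S : Store ι} (h : M l = jump l') :
    TM2.step M (idleCfg l S) = some (idleCfg l' S) := by
  simp only [idleCfg, TM2.step, h, jump, TM2.stepAux]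

theorem step_test_true {k : ι} {c : Option Γ' → Bool} {l l₁ l₂ : Λ} {S : Store ι}
    (h : M l = test k c l₁ l₂) (hc : c (S k).head? = true) :
    TM2.step M (idleCfg l S) = some (idleCfg l₁ S) := by
  simp only [idleCfg, TM2.step, h, test, jump, TM2.stepAux, glue_main, hc, cond_true]

theorem step_test_false {k : ι} {c : Option Γ' → Bool} {l l₁ l₂ : Λ} {S : Store ι}
    (h : M l = test k c l₁ l₂) (hc : c (S k).head? = false) :
    TM2.step M (idleCfg l S) = some (idleCfg l₂ S) := by
  simp only [idleCfg, TM2.step, h, test, jump, TM2.stepAux, glue_main, hc, cond_false]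

theorem steps_loadStmt {i : ι} {l l' : Λ} (hl : M l = loadStmt i l l') (w : List Γ') (S : Store ι)
    (T : List (O.tm.Γ O.tm.k₀)) (hS : S i = w) :
    Steps (TM2.step M) (w.length + 1)
      ⟨some l, (none, O.tm.initialState), glue [] S (update (fun _ => []) O.tm.k₀ T)⟩
      ⟨some l', (none, O.tm.initialState), glue [] (update S i [])
        (update (fun _ => []) O.tm.k₀ (w.reverse.map O.inputAlphabet.invFun ++ T))⟩ := by
  induction w generalizing S T with
  | nil => exact .single (by simp [TM2.step, hl, loadStmt, jump, hS])
  | cons a w ih =>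
    rw [List.length_cons, add_comm]
    refine Steps.trans (.single (by simp [TM2.step, hl, loadStmt, jump, hS]; rfl)) ?_
    simpa using ih (update S i w) (O.inputAlphabet.invFun a :: T) (by simp)

theorem steps_unloadStmt {o : ι} {l l' : Λ} (hl : M l = unloadStmt o l l') (u : List Γ')
    (S : Store ι) :
    Steps (TM2.step M) (u.length + 1)
      ⟨some l, (none, O.tm.initialState),
        glue [] S (update (fun _ => []) O.tm.k₁ (u.map O.outputAlphabet.invFun))⟩
      (idleCfg l' (update S o (u.reverse ++ S o))) := by
  induction u generalizing S with
  | nil => exact .single (by simp [TM2.step, hl, unloadStmt, jump, idleCfg])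
  | cons a u ih =>
    rw [List.length_cons, add_comm]
    refine Steps.trans (.single (by simp [TM2.step, hl, unloadStmt, jump]; rfl)) ?_
    simpa using ih (update S o (a :: S o))

theorem initList_eq (tm : FinTM2) (s : List (tm.Γ tm.k₀)) :
    initList tm s = ⟨some tm.main, tm.initialState, update (fun _ => []) tm.k₀ s⟩ := by
  unfold initList
  congr 1
  funext k
  obtain rfl | h := eq_or_ne k tm.k₀ <;> simp [*]

theorem haltList_eq (tm : FinTM2) (s : List (tm.Γ tm.k₁)) :
    haltList tm s = ⟨none, tm.initialState, update (fun _ => []) tm.k₁ s⟩ := by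
  unfold haltList
  congr 1
  funext k
  obtain rfl | h := eq_or_ne k tm.k₁ <;> simp [*]

theorem steps_call {i o : ι} {e : Label O (.call i o) → Λ} {exit : Λ} {S : Store ι} {w u : List Γ'}
    {n : ℕ} (hM : ∀ l, M (e l) = code (.call i o) e exit l) (hi : S i = w.reverse)
    (h : Answers O w u n) :
    Steps (TM2.step M) (w.length + 1 + n + (u.length + 1)) (idleCfg (e (entry O (.call i o))) S)
      (idleCfg exit (update (update S i []) o (u.reverse ++ update S i [] o))) := by
  have hload := steps_loadStmt (hM CallLabel.load) w.reverse S [] hi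
  have hrun := steps_liftCfg (update S i []) (fun l => hM (CallLabel.run l)) h
  have hunload := steps_unloadStmt (hM CallLabel.unload) u (update S i [])
  rw [initList_eq, haltList_eq] at hrun
  simp only [List.length_reverse, List.reverse_reverse, List.append_nil,
    update_eq_self_iff.mpr] at hload
  exact (hload.trans hrun).trans hunload

theorem Exec.steps {p : Prog ι} {S S' : Store ι} {n : ℕ} (h : Exec O p S n S')
    {e : Label O p → Λ} {exit : Λ} (hM : ∀ l, M (e l) = code p e exit l) :
    Steps (TM2.step M) n (idleCfg (e (entry O p)) S) (idleCfg exit S') := by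
  induction h generalizing exit with
  | skip S => exact .single (step_jump (hM _))
  | push k a S => exact .single (by simp [idleCfg, TM2.step, hM, code, jump])
  | pop k S => exact .single (by simp [idleCfg, TM2.step, hM, code, jump])
  | copyTop k k' S a l h => exact .single (by simp [idleCfg, TM2.step, hM, code, jump, h])
  | seq _ _ ih ih' =>
    exact (ih (e := fun l => e (.inl l)) fun l => hM (.inl l)).trans
      (ih' (e := fun l => e (.inr l)) fun l => hM (.inr l))
  | ite_true hc _ ih =>
    exact (Steps.single (step_test_true (hM none) hc)).trans
      (ih (e := fun l => e (some (.inl l))) fun l => hM (some (.inl l)))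
  | ite_false hc _ ih =>
    exact (Steps.single (step_test_false (hM none) hc)).trans
      (ih (e := fun l => e (some (.inr l))) fun l => hM (some (.inr l)))
  | while_true hc _ _ ih ih' =>
    exact ((Steps.single (step_test_true (hM none) hc)).trans
      (ih (e := fun l => e (some l)) fun l => hM (some l))).trans (ih' hM)
  | while_false hc => exact .single (step_test_false (hM none) hc)
  | call hi h => exact steps_call hM hi h

end Compile

section Machine

variable [DecidableEq ι]

/-- The machine that runs `p` on the stack `inp` and answers whether the stack `flag` is nonempty
at the end. -/
noncomputable def machine [Fintype ι] (O : TM2ComputableAux Γ' Γ') (p : Prog ι)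
    (inp flag : ι) : FinTM2 :=
  letI := O.tm.kFin
  letI := O.tm.σFin
  { K := Stack ι O.tm.K
    k₀ := .main inp
    k₁ := .answer
    Γ := Alphabet O
    Λ := Option (Label O p)
    main := some (entry O p)
    ΛFin := Fintype.ofFinite _
    σ := Register O
    initialState := (none, O.tm.initialState)
    Γk₀Fin := inferInstanceAs (Fintype Γ')
    m := fun l => l.elim (answerStmt flag) (code p some none) }

variable {O : TM2ComputableAux Γ' Γ'} {p : Prog ι} {inp flag : ι}

theorem initList_machine [Fintype ι] (w : List Γ') :
    initList (machine O p inp flag) w =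
      idleCfg (some (entry O p)) (update (fun _ => []) inp w) := by
  refine (initList_eq _ _).trans (congrArg (TM2.Cfg.mk _ _) ?_)
  rw [← update_glue_main, glue_nil]
  rfl

theorem haltList_machine [Fintype ι] (b : Bool) :
    haltList (machine O p inp flag) [b] =
      ⟨none, (none, O.tm.initialState), glue [b] (fun _ => []) fun _ => []⟩ := by
  refine (haltList_eq _ _).trans (congrArg (TM2.Cfg.mk _ _) ?_)
  rw [← update_glue_answer [], glue_nil]
  rfl

theorem steps_machine_halt [Fintype ι] (P : Prop) [Decidable P] :
    Steps (machine O p inp flag).step 1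
      (idleCfg none (update (fun _ => []) flag (if P then [one] else [])))
      (haltList (machine O p inp flag) [decide P]) := by
  have hanswer : TM2.stepAux (answerStmt (Λ := Option (Label O p)) flag)
      (none, O.tm.initialState)
      (glue [] (update (fun _ => []) flag (if P then [one] else [])) fun _ => []) =
      ⟨none, (none, O.tm.initialState), glue [decide P] (fun _ => []) fun _ => []⟩ := by
    by_cases hP : P <;> simp [answerStmt, hP]
  exact .single (congrArg some (hanswer.trans (haltList_machine _).symm))

open Classical in
theorem polyTimeDecidable_of_runsIn [Finite ι] {α : Type} {enc : α → List Γ'} {P : α → Prop}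
    (T : Polynomial ℕ)
    (h : ∀ a, RunsIn O p (update (fun _ => []) inp (enc a))
      (update (fun _ => []) flag (if P a then [one] else [])) (T.eval (enc a).length)) :
    UpToL.PolyTimeDecidable enc P := by
  let := Fintype.ofFinite ι
  choose n hn hex using h
  refine ⟨fun a => decide (P a), by simp, ⟨?_⟩⟩
  refine
    { tm := machine O p inp flag
      inputAlphabet := Equiv.refl _
      outputAlphabet := Equiv.refl _
      time := T + 1
      outputsFun := fun a => ⟨⟨n a + 1, ?_⟩, by simpa using hn a⟩ }
  have hinitial : initList (machine O p inp flag) ((enc a).map id) =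
      idleCfg (some (entry O p)) (update (fun _ => []) inp (enc a)) :=
    (congrArg _ (List.map_id _)).trans (initList_machine _)
  have hrun := (hex a).steps (M := (machine O p inp flag).m) (e := some) (exit := none) fun _ => rfl
  exact (congrArg (fun c => (flip bind _)^[n a + 1] (some c)) hinitial).trans
    (hrun.trans (steps_machine_halt (P a)))

end Machine

section RunsIn

variable [DecidableEq ι] {O : TM2ComputableAux Γ' Γ'} {p q : Prog ι} {S S' S'' : Store ι}
  {T T' : ℕ}

theorem RunsIn.weaken (h : RunsIn O p S S' T) (hS : S' = S'') (hT : T ≤ T') :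
    RunsIn O p S S'' T' :=
  let ⟨n, hn, h⟩ := h; ⟨n, hn.trans hT, hS ▸ h⟩

theorem runsIn_skip : RunsIn O .skip S S 1 := ⟨1, le_rfl, .skip S⟩

theorem runsIn_push (k : ι) (a : Γ') : RunsIn O (.push k a) S (update S k (a :: S k)) 1 :=
  ⟨1, le_rfl, .push k a S⟩

theorem runsIn_pop (k : ι) : RunsIn O (.pop k) S (update S k (S k).tail) 1 :=
  ⟨1, le_rfl, .pop k S⟩

theorem runsIn_copyTop {k : ι} (k' : ι) {a : Γ'} {l : List Γ'} (h : S k = a :: l) :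
    RunsIn O (.copyTop k k') S (update S k' (a :: S k')) 1 :=
  ⟨1, le_rfl, .copyTop k k' S a l h⟩

theorem RunsIn.seq (h : RunsIn O p S S' T) (h' : RunsIn O q S' S'' T') :
    RunsIn O (.seq p q) S S'' (T + T') :=
  let ⟨_, hn, h⟩ := h; let ⟨_, hn', h'⟩ := h'; ⟨_, add_le_add hn hn', .seq h h'⟩

theorem RunsIn.ite_true {k : ι} {c : Option Γ' → Bool} (hc : c (S k).head? = true)
    (h : RunsIn O p S S' T) : RunsIn O (.ite k c p q) S S' (1 + T) :=
  let ⟨_, hn, h⟩ := h; ⟨_, add_le_add le_rfl hn, .ite_true hc h⟩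

theorem RunsIn.ite_false {k : ι} {c : Option Γ' → Bool} (hc : c (S k).head? = false)
    (h : RunsIn O q S S' T) : RunsIn O (.ite k c p q) S S' (1 + T) :=
  let ⟨_, hn, h⟩ := h; ⟨_, add_le_add le_rfl hn, .ite_false hc h⟩

theorem runsIn_while {k : ι} {c : Option Γ' → Bool} (N : ℕ) (R : ℕ → Store ι)
    (hc : ∀ i < N, c (R i k).head? = true) (hN : c (R N k).head? = false)
    (h : ∀ i < N, RunsIn O p (R i) (R (i + 1)) T) :
    RunsIn O (.while k c p) (R 0) (R N) (N * (1 + T) + 1) := by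
  induction N generalizing R with
  | zero => exact ⟨1, by simp, .while_false hN⟩
  | succ N ih =>
    obtain ⟨n, hn, hhead⟩ := h 0 (by omega)
    obtain ⟨n', hn', htail⟩ := ih (fun i => R (i + 1)) (fun i hi => hc _ (by omega)) hN
      (fun i hi => h _ (by omega))
    exact ⟨_, by linarith, .while_true (hc 0 (by omega)) hhead htail⟩

end RunsIn

/-- Push a word, first symbol first. -/
def pushAll (k : ι) : List Γ' → Prog ι
  | [] => .skip
  | a :: w => .seq (.push k a) (pushAll k w)

/-- Move the symbols of stack `k`, as long as `c` holds for the top, to stack `v`. -/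
def moveWhile (c : Option Γ' → Bool) (k v : ι) : Prog ι :=
  .while k c (.seq (.copyTop k v) (.pop k))

/-- Empty a stack. -/
def clear (k : ι) : Prog ι := .while k Option.isSome (.pop k)

/-- Run `p` for every symbol of stack `k`, using stack `tmp` to restore `k` afterwards. -/
def forEach (k tmp : ι) (p : Prog ι) : Prog ι :=
  .seq (.while k Option.isSome (.seq p (.seq (.copyTop k tmp) (.pop k))))
    (moveWhile Option.isSome tmp k)

/-- Push the symbols of stack `k`, top first, on stack `v`. -/
def copy (k v tmp : ι) : Prog ι := forEach k tmp (.copyTop k v)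

/-- Remove equally many symbols from the stacks `k` and `k'`, as many as are needed to empty `k`;
the excess of `k` over `k'` is pushed on stack `e`. -/
def cancel (k k' e : ι) : Prog ι :=
  .while k Option.isSome (.seq (.pop k) (.ite k' Option.isSome (.pop k') (.push e one)))

/-- Empty the stacks `k` and `k'`, and run `p` if they had the same height. -/
def ifEqHeight (k k' e : ι) (p : Prog ι) : Prog ι :=
  .seq (cancel k k' e) (.ite e Option.isSome (clear e) (.ite k' Option.isSome (clear k') p))

section Basic

variable [DecidableEq ι] {O : TM2ComputableAux Γ' Γ'} {k k' v e tmp : ι}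

theorem runsIn_pushAll (k : ι) (w : List Γ') (S : Store ι) :
    RunsIn O (pushAll k w) S (update S k (w.reverse ++ S k)) (w.length + 1) := by
  induction w generalizing S with
  | nil => exact runsIn_skip.weaken (by simp) le_rfl
  | cons a w ih =>
    exact ((runsIn_push k a).seq (ih _)).weaken (by simp)
      (by simp only [List.length_cons]; omega)

theorem reverse_take_succ {w : List Γ'} {i : ℕ} (hi : i < w.length) :
    (w.take (i + 1)).reverse = w[i] :: (w.take i).reverse := by
  rw [← List.take_concat_get' w i hi, List.reverse_concat]

theorem runsIn_moveWhile {c : Option Γ' → Bool} (hkv : k ≠ v) {S : Store ι} {w r : List Γ'}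
    (hS : S k = w ++ r) (hw : ∀ a ∈ w, c (some a) = true) (hr : c r.head? = false) :
    RunsIn O (moveWhile c k v) S (update (update S k r) v (w.reverse ++ S v))
      (3 * w.length + 1) := by
  have hloop := runsIn_while (O := O) (p := .seq (.copyTop k v) (.pop k)) (k := k) (c := c)
    (T := 2) w.length
    (fun i => update (update S k (w.drop i ++ r)) v ((w.take i).reverse ++ S v))
    (fun i hi => by simp [hkv, hi, hw]) (by simpa [hkv] using hr)
    fun i hi => by
      have hdrop : w.drop i = w[i] :: w.drop (i + 1) := List.drop_eq_getElem_cons hi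
      refine ((runsIn_copyTop v (a := w[i]) (l := w.drop (i + 1) ++ r) ?_).seq
        (runsIn_pop k)).weaken ?_ le_rfl
      · simp [-List.getElem_cons_drop, hkv, hdrop]
      · simp [-List.getElem_cons_drop, hkv, hdrop, update_comm hkv.symm, reverse_take_succ hi]
  simp only [List.drop_zero, List.take_zero, List.reverse_nil, List.nil_append, ← hS,
    update_eq_self, List.drop_length, List.take_length] at hloop
  exact hloop.weaken rfl (by omega)

theorem runsIn_clear (k : ι) (S : Store ι) :
    RunsIn O (clear k) S (update S k []) (2 * (S k).length + 1) := by
  have hloop := runsIn_while (O := O) (p := .pop k) (k := k) (c := Option.isSome) (T := 1)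
    (S k).length (fun i => update S k ((S k).drop i)) (fun i hi => by simp [hi]) (by simp)
    fun i _ => (runsIn_pop k).weaken (by simp) le_rfl
  simp only [List.drop_zero, update_eq_self, List.drop_length] at hloop
  exact hloop.weaken rfl (by omega)

theorem runsIn_forEach (hkt : k ≠ tmp) {p : Prog ι} {w : List Γ'} {T : ℕ} (F : ℕ → Store ι)
    (hk : ∀ i, F i k = w) (ht : ∀ i, F i tmp = [])
    (hp : ∀ i < w.length, ∀ l,
      RunsIn O p (update (update (F i) k (w.drop i)) tmp l)
        (update (update (F (i + 1)) k (w.drop i)) tmp l) T) :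
    RunsIn O (forEach k tmp p) (F 0) (F w.length) (w.length * (T + 6) + 2) := by
  have hloop := runsIn_while (O := O) (p := .seq p (.seq (.copyTop k tmp) (.pop k))) (k := k)
    (c := Option.isSome) (T := T + 2) w.length
    (fun i => update (update (F i) k (w.drop i)) tmp (w.take i).reverse)
    (fun i hi => by simp [hkt, hi]) (by simp [hkt]) fun i hi => by
      have hdrop : w.drop i = w[i] :: w.drop (i + 1) := List.drop_eq_getElem_cons hi
      refine ((hp i hi _).seq ((runsIn_copyTop tmp (a := w[i]) (l := w.drop (i + 1)) ?_).seq
        (runsIn_pop k))).weaken ?_ le_rfl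
      · simp [-List.getElem_cons_drop, hkt, hdrop]
      · simp [hkt, update_comm hkt.symm, reverse_take_succ hi]
  have hrestore := runsIn_moveWhile (O := O) (c := Option.isSome) (w := w.reverse) (r := [])
    (S := update (update (F w.length) k []) tmp w.reverse) hkt.symm (by simp) (by simp) rfl
  have hF : ∀ i, update (update (F i) k w) tmp [] = F i := fun i => by
    rw [(update_eq_self_iff (f := F i)).mpr (hk i).symm, update_eq_self_iff.mpr (ht i).symm]
  simp only [List.drop_zero, List.take_zero, List.reverse_nil, hF, List.drop_length,
    List.take_length] at hloop
  refine (hloop.seq hrestore).weaken ?_ (by rw [List.length_reverse]; linarith)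
  simpa [hkt, update_comm hkt.symm] using hF w.length

theorem runsIn_copy (hkt : k ≠ tmp) (hkv : k ≠ v) (htv : tmp ≠ v) {S : Store ι}
    (ht : S tmp = []) :
    RunsIn O (copy k v tmp) S (update S v ((S k).reverse ++ S v)) (7 * (S k).length + 2) := by
  have hloop := runsIn_forEach (O := O) (p := .copyTop k v) (w := S k) (T := 1) hkt
    (fun i => update S v (((S k).take i).reverse ++ S v)) (by simp [hkv]) (by simp [htv, ht])
    fun i hi l => by
      have hdrop : (S k).drop i = (S k)[i] :: (S k).drop (i + 1) := List.drop_eq_getElem_cons hi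
      refine (runsIn_copyTop v (a := (S k)[i]) (l := (S k).drop (i + 1)) ?_).weaken ?_ le_rfl
      · simp [-List.getElem_cons_drop, hkt, hdrop]
      · simp [hkv.symm, htv.symm, update_comm hkv, update_comm htv, reverse_take_succ hi]
  simp only [List.take_zero, List.reverse_nil, List.nil_append, update_eq_self,
    List.take_length] at hloop
  exact hloop.weaken rfl (by omega)

theorem runsIn_cancel (hkk' : k ≠ k') (hke : k ≠ e) (hke' : k' ≠ e) {S : Store ι}
    (he : S e = []) :
    RunsIn O (cancel k k' e) S
      (update (update (update S k []) k' ((S k').drop (S k).length)) e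
        (List.replicate ((S k).length - (S k').length) one)) (4 * (S k).length + 1) := by
  have hloop := runsIn_while (O := O) (k := k) (c := Option.isSome) (T := 3)
    (p := .seq (.pop k) (.ite k' Option.isSome (.pop k') (.push e one))) (S k).length
    (fun i => update (update (update S k ((S k).drop i)) k' ((S k').drop i)) e
      (List.replicate (i - (S k').length) one))
    (fun i hi => by simp [hkk', hke, hi]) (by simp [hkk', hke]) fun i _ => by
      refine (runsIn_pop k).seq (T' := 2) ?_
      by_cases h : i < (S k').length
      · refine (RunsIn.ite_true ?_ (runsIn_pop k')).weaken ?_ le_rfl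
        · simp [hkk'.symm, hke', h]
        · simp [hkk', hkk'.symm, hke, hke', update_comm hkk'.symm, update_comm hke'.symm,
            update_comm hke.symm, h.le, Nat.sub_eq_zero_of_le h]
      · have hdrop : ∀ j ≥ i, (S k').drop j = [] := fun j hj =>
          List.drop_eq_nil_of_le (by omega)
        refine (RunsIn.ite_false ?_ (runsIn_push e one)).weaken ?_ le_rfl
        · simp [hkk'.symm, hke', hdrop]
        · simp [hkk', hke, update_comm hkk'.symm, update_comm hke.symm,
            Nat.sub_add_comm (not_lt.mp h), List.replicate_succ, hdrop]
  have hS : update (update (update S k (S k)) k' (S k')) e [] = S := by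
    rw [update_eq_self k S, update_eq_self k' S, ← he, update_eq_self]
  simp only [List.drop_zero, Nat.zero_sub, List.replicate_zero, hS, List.drop_length] at hloop
  exact hloop.weaken rfl (by omega)

theorem runsIn_ifEqHeight (hkk' : k ≠ k') (hke : k ≠ e) (hke' : k' ≠ e) {p : Prog ι}
    {S S' : Store ι} {T : ℕ} (he : S e = [])
    (hp : RunsIn O p (update (update S k []) k' []) S' T) :
    RunsIn O (ifEqHeight k k' e p) S
      (if (S k).length = (S k').length then S' else update (update S k []) k' [])
      (6 * (S k).length + 2 * (S k').length + T + 5) := by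
  have hcancel := runsIn_cancel (O := O) hkk' hke hke' he
  have hnil : update (update (update S k []) k' []) e [] = update (update S k []) k' [] := by
    simp [hke.symm, hke'.symm, he]
  obtain h | h | h := lt_trichotomy (S k).length (S k').length
  · rw [Nat.sub_eq_zero_of_le h.le, List.replicate_zero] at hcancel
    refine (hcancel.seq (.ite_false ?_ (.ite_true ?_ (runsIn_clear k' _)))).weaken ?_ ?_
    · simp
    · simp [hke', h]
    · simp [h.ne, update_comm hke'.symm, hnil]
    · simp only [ne_eq, hke', not_false_eq_true, update_of_ne, update_self, List.length_drop]
      omega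
  · rw [h, Nat.sub_self, List.replicate_zero, List.drop_length, hnil] at hcancel
    refine (hcancel.seq (.ite_false ?_ (.ite_false ?_ hp))).weaken ?_ ?_
    · simp [hke.symm, hke'.symm, he]
    · simp
    · simp [h]
    · omega
  · rw [List.drop_eq_nil_of_le h.le] at hcancel
    refine (hcancel.seq (.ite_true ?_ (runsIn_clear e _))).weaken ?_ ?_
    · simp only [update_self, List.head?_replicate, Option.isSome_ite']
      omega
    · simp [h.ne', hnil]
    · simp only [update_self, List.length_replicate]
      omega

end Basic

/-- The stacks of a program that searches through the values of counters indexed by `V`: the unread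
input, the bound of the counters, the targeted answer, the result of the search, work space, and
the counters. -/
inductive Reg (V : Type) : Type
  | inp | bound | target | flag | fst | snd | err | dup | tmp | arg
  | counter (v : V)
  deriving DecidableEq, Fintype

/-- The data that do not change during a search. -/
structure Input : Type where
  inp : List Γ'
  bound : ℕ
  target : ℕ

section Search

variable {V : Type}

open Classical in
/-- The stacks during a search, when the counters have the values `x`; `F` says whether a solution
has been found. -/
noncomputable def Input.store (I : Input) (x : V → ℕ) (F : Prop) : Store (Reg V)
  | .inp => I.inp
  | .bound => List.replicate I.bound one
  | .target => List.replicate I.target one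
  | .flag => if F then [one] else []
  | .counter v => List.replicate (x v) one
  | _ => []

variable [DecidableEq V] {O : TM2ComputableAux Γ' Γ'} {I : Input} {p : Prog (Reg V)} {x : V → ℕ}
  {v : V} {T : ℕ}

theorem update_store_counter (n : ℕ) (F : Prop) :
    update (I.store x F) (.counter v) (List.replicate n one) = I.store (update x v n) F := by
  funext k
  cases k with
  | counter w => obtain rfl | h := eq_or_ne w v <;> simp [Input.store, *]
  | _ => simp [Input.store]

/-- The program `p`, started with counters `x`, reports a solution if `Q` holds. -/
def Tests (O : TM2ComputableAux Γ' Γ') (I : Input) (p : Prog (Reg V)) (x : V → ℕ) (Q : Prop)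
    (T : ℕ) : Prop :=
  ∀ F, RunsIn O p (I.store x F) (I.store x (F ∨ Q)) T

/-- Run `p` for all values of the counter `v` below the bound, in decreasing order. -/
def forBelow (v : V) (p : Prog (Reg V)) : Prog (Reg V) :=
  .seq (copy .bound (.counter v) .tmp)
    (.while (.counter v) Option.isSome (.seq (.pop (.counter v)) p))

theorem tests_forBelow {Q : ℕ → Prop} (hv : x v = 0)
    (hp : ∀ i < I.bound, Tests O I p (update x v i) (Q i) T) :
    Tests O I (forBelow v p) x (∃ i < I.bound, Q i)
      (7 * I.bound + 2 + (I.bound * (T + 2) + 1)) := by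
  intro F
  have hcopy := runsIn_copy (O := O) (k := .bound) (v := .counter v) (tmp := .tmp)
    (S := I.store x F) (by simp) (by simp) (by simp) rfl
  have hstart : update (I.store x F) (.counter v)
      ((I.store x F .bound).reverse ++ I.store x F (.counter v)) =
        I.store (update x v I.bound) F := by
    rw [← update_store_counter]
    simp [Input.store, hv]
  let found (j : ℕ) : Prop := F ∨ ∃ i, I.bound - j ≤ i ∧ i < I.bound ∧ Q i
  have hfound_zero : found 0 = F :=
    propext (or_iff_left fun ⟨i, hle, hlt, _⟩ => hle.not_gt hlt)
  have hfound_succ : ∀ j < I.bound, (found j ∨ Q (I.bound - (j + 1))) = found (j + 1) := by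
    intro j hj
    have hle : ∀ i, I.bound - (j + 1) ≤ i ↔ I.bound - j ≤ i ∨ i = I.bound - (j + 1) := by omega
    have hlt : I.bound - (j + 1) < I.bound := by omega
    simp only [found, hle, or_and_right, exists_or, exists_eq_left, hlt, true_and, or_assoc]
  have hfound_bound : found I.bound = (F ∨ ∃ i < I.bound, Q i) := by simp [found]
  have hloop := runsIn_while (O := O) (k := .counter v) (c := Option.isSome)
    (p := .seq (.pop (.counter v)) p) (T := 1 + T) I.bound
    (fun j => I.store (update x v (I.bound - j)) (found j))
    (fun j hj => by
      simp only [Input.store, update_self, List.head?_replicate, Option.isSome_ite']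
      omega)
    (by simp [Input.store])
    fun j hj => by
      have hpop := runsIn_pop (O := O) (S := I.store (update x v (I.bound - j)) (found j))
        (.counter v)
      rw [show (I.store (update x v (I.bound - j)) (found j) (.counter v)).tail =
        List.replicate (I.bound - (j + 1)) one by simp [Input.store, Nat.sub_sub],
        update_store_counter, update_idem] at hpop
      exact hpop.seq ((hp _ (by omega) _).weaken (by rw [hfound_succ j hj]) le_rfl)
  have hend : update x v 0 = x := by rw [← hv, update_eq_self]
  simp only [hfound_zero, hfound_bound, Nat.sub_zero, Nat.sub_self, hend] at hloop
  rw [hstart] at hcopy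
  exact (hcopy.seq hloop).weaken rfl
    (add_le_add (by simp [Input.store]) (by rw [← add_assoc, add_comm T]))

/-- Run `p` for all values below the bound of the counters in a list. -/
def search (p : Prog (Reg V)) : List V → Prog (Reg V)
  | [] => p
  | v :: vs => forBelow v (search p vs)

/-- The time needed for the search. -/
def searchTime (N T : ℕ) : ℕ → ℕ
  | 0 => T
  | k + 1 => 7 * N + 2 + (N * (searchTime N T k + 2) + 1)

theorem tests_search {Q : (V → ℕ) → Prop}
    (hp : ∀ y, (∀ v, y v < I.bound) → Tests O I p y (Q y) T) {vs : List V} (hvs : vs.Nodup)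
    (hmem : ∀ v ∈ vs, x v = 0) (hnmem : ∀ v ∉ vs, x v < I.bound) :
    Tests O I (search p vs) x (∃ y, (∀ v, y v < I.bound) ∧ (∀ v ∉ vs, y v = x v) ∧ Q y)
      (searchTime I.bound T vs.length) := by
  induction vs generalizing x with
  | nil =>
    intro F
    refine (hp x (fun v => hnmem v (by simp)) F).weaken ?_ le_rfl
    congr! 2
    exact ⟨fun h => ⟨x, fun v => hnmem v (by simp), fun _ _ => rfl, h⟩,
      fun ⟨y, _, hy, h⟩ => funext (fun v => hy v (by simp)) ▸ h⟩
  | cons v vs ih =>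
    obtain ⟨hv, hvs⟩ := List.nodup_cons.mp hvs
    intro F
    refine (tests_forBelow (hmem v (by simp)) (fun i hi =>
      ih hvs (x := update x v i) (fun w hw => ?_) fun w hw => ?_) F).weaken ?_ le_rfl
    · rw [update_of_ne (ne_of_mem_of_not_mem hw hv)]
      exact hmem w (by simp [hw])
    · obtain rfl | hwv := eq_or_ne w v
      · simpa using hi
      · simpa [hwv] using hnmem w (by simp [hw, hwv])
    · congr! 2
      constructor
      · rintro ⟨i, -, y, hy, heq, hQ⟩
        exact ⟨y, hy, fun w hw => by simp_all, hQ⟩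
      · rintro ⟨y, hy, heq, hQ⟩
        refine ⟨y v, hy v, y, hy, fun w hw => ?_, hQ⟩
        obtain rfl | hwv := eq_or_ne w v
        · simp
        · simpa [hwv] using heq w (by simp [hw, hwv])

end Search

section Report

variable {V : Type} [DecidableEq V] {O : TM2ComputableAux Γ' Γ'} {I : Input} {x : V → ℕ}
  {p : Prog (Reg V)}

/-- Report a solution. -/
def report : Prog (Reg V) := .ite .flag Option.isSome .skip (.push .flag one)

theorem tests_report : Tests O I report x True 2 := by
  intro F
  by_cases hF : F
  · exact (RunsIn.ite_true (by simp [Input.store, hF]) runsIn_skip).weaken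
      (by simp [hF]) le_rfl
  · refine (RunsIn.ite_false (by simp [Input.store, hF]) (runsIn_push _ _)).weaken ?_ le_rfl
    funext k
    cases k <;> simp [Input.store, hF]

/-- Call the machine on the word that `p` assembles, and report a solution if the answer has as
many symbols as the target. -/
def accept (p : Prog (Reg V)) : Prog (Reg V) :=
  .seq p (.seq (.call .arg .fst) (.seq (copy .target .snd .tmp) (ifEqHeight .fst .snd .err report)))

theorem tests_accept {w u : List Γ'} {n T : ℕ}
    (hp : ∀ F, RunsIn O p (I.store x F) (update (I.store x F) .arg w.reverse) T)
    (h : Answers O w u n) :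
    Tests O I (accept p) x (u.length = I.target)
      (T + w.length + n + 7 * u.length + 9 * I.target + 11) := by
  intro F
  have hcall : RunsIn O (.call .arg .fst) (update (I.store x F) .arg w.reverse)
      (update (I.store x F) .fst u.reverse) (w.length + 1 + n + (u.length + 1)) := by
    refine RunsIn.weaken ⟨_, le_rfl, .call (w := w) (by simp) h⟩ ?_ le_rfl
    have hnil : update (I.store x F) .arg [] = I.store x F := update_eq_self .arg (I.store x F)
    simp [hnil, Input.store]
  have hcopy : RunsIn O (copy .target .snd .tmp) (update (I.store x F) .fst u.reverse)
      (update (update (I.store x F) .fst u.reverse) .snd (List.replicate I.target one))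
      (7 * I.target + 2) :=
    (runsIn_copy (by simp) (by simp) (by simp) rfl).weaken (by simp [Input.store])
      (by simp [Input.store])
  have hclear : update (update (update (update (I.store x F) .fst u.reverse) .snd
      (List.replicate I.target one)) .fst []) .snd [] = I.store x F := by
    have hfst : update (I.store x F) .fst [] = I.store x F := update_eq_self .fst (I.store x F)
    have hsnd : update (I.store x F) .snd [] = I.store x F := update_eq_self .snd (I.store x F)
    simp [update_comm, hfst, hsnd]
  have hcompare := runsIn_ifEqHeight (O := O) (k := .fst) (k' := .snd) (e := .err)
    (S := update (update (I.store x F) .fst u.reverse) .snd (List.replicate I.target one))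
    (by simp) (by simp) (by simp) rfl (by rw [hclear]; exact tests_report F)
  refine ((hp F).seq (hcall.seq (hcopy.seq hcompare))).weaken ?_ ?_
  · by_cases hu : u.length = I.target <;> simp [hu, hclear]
  · simp only [ne_eq, reduceCtorEq, not_false_eq_true, update_of_ne, update_self,
      List.length_reverse, List.length_replicate]
    omega

end Report

/-- The program `p` appends the word `w`, reversed, to the stack `k` in at most `T` steps, whatever
`k` holds. -/
def Appends [DecidableEq ι] (O : TM2ComputableAux Γ' Γ') (S : Store ι) (k : ι) (p : Prog ι)
    (w : List Γ') (T : ℕ) : Prop :=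
  w.length ≤ T ∧ ∀ l, RunsIn O p (update S k l) (update S k (w.reverse ++ l)) T

/-- Run a list of programs one after the other. -/
def seqAll : List (Prog ι) → Prog ι
  | [] => .skip
  | p :: ps => .seq p (seqAll ps)

section Appends

variable [DecidableEq ι] {O : TM2ComputableAux Γ' Γ'} {S : Store ι} {k v tmp : ι}
  {p q : Prog ι} {w w' : List Γ'} {T T' : ℕ}

theorem Appends.runsIn (h : Appends O S k p w T) (hk : S k = []) :
    RunsIn O p S (update S k w.reverse) T := by
  have hS : update S k [] = S := update_eq_self_iff.mpr hk.symm
  simpa [hS] using h.2 []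

theorem Appends.seq (h : Appends O S k p w T) (h' : Appends O S k q w' T') :
    Appends O S k (.seq p q) (w ++ w') (T + T') :=
  ⟨by simpa using add_le_add h.1 h'.1,
    fun l => ((h.2 l).seq (h'.2 _)).weaken (by simp) le_rfl⟩

theorem Appends.mono (h : Appends O S k p w T) (hT : T ≤ T') : Appends O S k p w T' :=
  ⟨h.1.trans hT, fun l => (h.2 l).weaken rfl hT⟩

theorem appends_seqAll {α : Type} {p : α → Prog ι} {w : α → List Γ'} (as : List α)
    (h : ∀ a ∈ as, Appends O S k (p a) (w a) T) :
    Appends O S k (seqAll (as.map p)) (as.flatMap w) (as.length * T + 1) := by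
  induction as with
  | nil => exact ⟨by simp, fun l => runsIn_skip.weaken (by simp) (by simp)⟩
  | cons a as ih =>
    exact ((h a (by simp)).seq (ih fun b hb => h b (by simp [hb]))).mono
      (by rw [List.length_cons]; linarith)

theorem appends_pushAll (w : List Γ') : Appends O S k (pushAll k w) w (w.length + 1) :=
  ⟨by simp, fun l => (runsIn_pushAll k w _).weaken (by simp) le_rfl⟩

theorem appends_copy (hvt : v ≠ tmp) (hvk : v ≠ k) (htk : tmp ≠ k) (ht : S tmp = []) :
    Appends O S k (copy v k tmp) (S v) (7 * (S v).length + 2) :=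
  ⟨by omega, fun l => (runsIn_copy hvt hvk htk (by simpa [htk] using ht)).weaken
    (by simp [hvk]) (by simp [hvk])⟩

end Appends

@[simp]
theorem length_encodeTally (n : ℕ) : (UpToL.encodeTally n).length = n + 1 := by
  simp [UpToL.encodeTally]

/-- Read two tallies from the input: the bound, which is increased by `k`, and the target. The comma
of the second tally is kept, since answers end with a comma. -/
def parse {V : Type} (k : ℕ) : Prog (Reg V) :=
  .seq (moveWhile (· == some one) .inp .bound) (.seq (.pop .inp)
    (.seq (pushAll .bound (List.replicate k one))
      (.seq (moveWhile (· == some one) .inp .target) (.seq (.pop .inp) (.push .target one)))))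

theorem runsIn_parse {V : Type} [DecidableEq V] {O : TM2ComputableAux Γ' Γ'} (k p c : ℕ)
    (w : List Γ') :
    RunsIn O (parse k)
      (update (fun _ : Reg V => []) .inp (UpToL.encodeTally p ++ UpToL.encodeTally c ++ w))
      (Input.store ⟨w, p + k, c + 1⟩ (fun _ => 0) False) (3 * p + 3 * c + k + 6) := by
  let S (inp : List Γ') (bound target : ℕ) : Store (Reg V) :=
    Input.store ⟨inp, bound, target⟩ (fun _ => 0) False
  have hbound : RunsIn O (moveWhile (· == some one) .inp .bound)
      (update (fun _ => []) .inp (UpToL.encodeTally p ++ UpToL.encodeTally c ++ w))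
      (S (Γ'.comma :: UpToL.encodeTally c ++ w) p 0) (3 * p + 1) := by
    refine (runsIn_moveWhile (w := List.replicate p one)
      (r := Γ'.comma :: UpToL.encodeTally c ++ w) (by simp) (by simp [UpToL.encodeTally])
      (by simp) rfl).weaken ?_ (by simp)
    funext j
    cases j <;> simp [S, Input.store]
  have hcomma : RunsIn O (.pop .inp) (S (Γ'.comma :: UpToL.encodeTally c ++ w) p 0)
      (S (UpToL.encodeTally c ++ w) p 0) 1 := by
    refine (runsIn_pop _).weaken ?_ le_rfl
    funext j
    cases j <;> simp [S, Input.store]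
  have hadd : RunsIn O (pushAll .bound (List.replicate k one)) (S (UpToL.encodeTally c ++ w) p 0)
      (S (UpToL.encodeTally c ++ w) (p + k) 0) (k + 1) := by
    refine (runsIn_pushAll _ _ _).weaken ?_ (by simp)
    funext j
    cases j <;> simp [S, Input.store, add_comm]
  have htarget : RunsIn O (moveWhile (· == some one) .inp .target)
      (S (UpToL.encodeTally c ++ w) (p + k) 0) (S (Γ'.comma :: w) (p + k) c) (3 * c + 1) := by
    refine (runsIn_moveWhile (w := List.replicate c one) (r := Γ'.comma :: w) (by simp)
      (by simp [S, Input.store, UpToL.encodeTally]) (by simp) rfl).weaken ?_ (by simp)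
    funext j
    cases j <;> simp [S, Input.store]
  refine (hbound.seq (hcomma.seq (hadd.seq (htarget.seq
    ((runsIn_pop _).seq (runsIn_push _ _)))))).weaken ?_ (by omega)
  funext j
  cases j <;> simp [S, Input.store, List.replicate_succ]

/-- `f` is bounded by a polynomial in `size`. -/
def PolyBound {α : Type} (size f : α → ℕ) : Prop := ∃ T : Polynomial ℕ, ∀ a, f a ≤ T.eval (size a)

section PolyBound

variable {α : Type} {size f g : α → ℕ}

theorem PolyBound.of_le (h : ∀ a, f a ≤ size a) : PolyBound size f := ⟨.X, by simpa using h⟩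

theorem PolyBound.const (c : ℕ) : PolyBound size fun _ => c := ⟨.C c, by simp⟩

theorem PolyBound.add (hf : PolyBound size f) (hg : PolyBound size g) :
    PolyBound size fun a => f a + g a :=
  let ⟨T, hT⟩ := hf; let ⟨U, hU⟩ := hg; ⟨T + U, fun a => by simpa using add_le_add (hT a) (hU a)⟩

theorem PolyBound.mul (hf : PolyBound size f) (hg : PolyBound size g) :
    PolyBound size fun a => f a * g a :=
  let ⟨T, hT⟩ := hf; let ⟨U, hU⟩ := hg; ⟨T * U, fun a => by simpa using mul_le_mul' (hT a) (hU a)⟩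

theorem eval_mono_nat (T : Polynomial ℕ) : Monotone fun n => T.eval n := by
  intro m n h
  simp only [Polynomial.eval_eq_sum]
  exact Finset.sum_le_sum fun i _ => Nat.mul_le_mul_left _ (Nat.pow_le_pow_left h i)

theorem PolyBound.eval (hf : PolyBound size f) (T : Polynomial ℕ) :
    PolyBound size fun a => T.eval (f a) :=
  let ⟨U, hU⟩ := hf; ⟨T.comp U, fun a => by simpa using eval_mono_nat T (hU a)⟩

theorem PolyBound.searchTime {N T : α → ℕ} (hN : PolyBound size N) (hT : PolyBound size T)
    (k : ℕ) : PolyBound size fun a => searchTime (N a) (T a) k := by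
  induction k with
  | zero => exact hT
  | succ k ih =>
    exact (((const 7).mul hN).add (const 2)).add ((hN.mul (ih.add (const 2))).add (const 1))

end PolyBound

/-- Read the input, search for a solution and tidy up. -/
noncomputable def decider {V : Type} [Fintype V] (k : ℕ) (p : Prog (Reg V)) : Prog (Reg V) :=
  .seq (parse k) (.seq (search p Finset.univ.toList)
    (.seq (clear .inp) (.seq (clear .bound) (clear .target))))

open Classical in
theorem runsIn_decider {V : Type} [Fintype V] [DecidableEq V] {O : TM2ComputableAux Γ' Γ'}
    {k p c T : ℕ} {w : List Γ'} {q : Prog (Reg V)} {Q : (V → Fin (p + k)) → Prop}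
    (hq : ∀ x, Tests O ⟨w, p + k, c + 1⟩ q (fun v => x v) (Q x) T) :
    RunsIn O (decider k q)
      (update (fun _ => []) .inp (UpToL.encodeTally p ++ UpToL.encodeTally c ++ w))
      (update (fun _ => []) .flag (if ∃ x, Q x then [one] else []))
      (5 * p + 5 * c + 2 * w.length + 3 * k + 11 + searchTime (p + k) T (Fintype.card V)) := by
  have hsearch := tests_search (O := O) (I := ⟨w, p + k, c + 1⟩) (p := q) (T := T)
    (x := fun _ => 0) (Q := fun y => ∃ h : ∀ v, y v < p + k, Q fun v => ⟨y v, h v⟩)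
    (fun y hy => by simpa [hy] using hq fun v => ⟨y v, hy v⟩)
    (Finset.nodup_toList Finset.univ) (by simp) (by simp) False
  have hQ : (∃ y : V → ℕ, ∃ h : ∀ v, y v < p + k, Q fun v => ⟨y v, h v⟩) ↔ ∃ x, Q x :=
    ⟨fun ⟨_, _, hy⟩ => ⟨_, hy⟩, fun ⟨x, hx⟩ => ⟨fun v => x v, fun v => (x v).2, hx⟩⟩
  refine ((runsIn_parse k p c w).seq (hsearch.seq ((runsIn_clear _ _).seq
    ((runsIn_clear _ _).seq (runsIn_clear _ _))))).weaken ?_ ?_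
  · funext j
    cases j <;> simp [Input.store, hQ]
  · simp [Input.store]
    omega

theorem polyTimeDecidable_exists {V : Type} [Finite V] [DecidableEq V] {O : TM2ComputableAux Γ' Γ'}
    {α : Type} {enc : α → List Γ'} {p c B : α → ℕ} {w : α → List Γ'} {k : ℕ} {q : Prog (Reg V)}
    {Q : (a : α) → (V → Fin (p a + k)) → Prop}
    (henc : ∀ a, enc a = UpToL.encodeTally (p a) ++ UpToL.encodeTally (c a) ++ w a)
    (hB : PolyBound (fun a => (enc a).length) B)
    (hq : ∀ a x, Tests O ⟨w a, p a + k, c a + 1⟩ q (fun v => x v) (Q a x) (B a)) :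
    UpToL.PolyTimeDecidable enc fun a => ∃ x, Q a x := by
  let := Fintype.ofFinite V
  have hlen : ∀ a, (enc a).length = p a + c a + (w a).length + 2 := fun a => by
    simp only [henc, List.length_append, length_encodeTally]; omega
  have hp : PolyBound (fun a => (enc a).length) p := .of_le fun a => by rw [hlen]; omega
  obtain ⟨T, hT⟩ : PolyBound (fun a => (enc a).length) fun a =>
      5 * (enc a).length + (3 * k + 11) + searchTime (p a + k) (B a) (Fintype.card V) :=
    (((PolyBound.const 5).mul (.of_le fun _ => le_rfl)).add (.const _)).add
      ((hp.add (.const k)).searchTime hB _)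
  refine polyTimeDecidable_of_runsIn (O := O) (p := decider k q) (inp := .inp) (flag := .flag) T
    fun a => ?_
  have hrun := runsIn_decider (hq a)
  rw [← henc] at hrun
  refine hrun.weaken (by congr) (le_trans ?_ (hT a))
  simp only [hlen]
  omega

theorem polyTimeDecidable_exists_eq {V : Type} [Finite V] [DecidableEq V] {α β : Type}
    {encα : α → List Γ'} {encβ : β → List Γ'} {f : β → ℕ}
    (M : TM2ComputableInPolyTime encβ UpToL.encodeTally f)
    {p c B : α → ℕ} {w : α → List Γ'} {k : ℕ} {q : Prog (Reg V)}
    (D : (a : α) → (V → Fin (p a + k)) → β)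
    (henc : ∀ a, encα a = UpToL.encodeTally (p a) ++ UpToL.encodeTally (c a) ++ w a)
    (hB : PolyBound (fun a => (encα a).length) B)
    (hf : ∀ a x, f (D a x) ≤ B a)
    (hq : ∀ a x F, Appends M.toTM2ComputableAux
      (Input.store ⟨w a, p a + k, c a + 1⟩ (fun v => x v) F) .arg q (encβ (D a x)) (B a)) :
    UpToL.PolyTimeDecidable encα fun a => ∃ x, f (D a x) = c a := by
  have hc : PolyBound (fun a => (encα a).length) c := .of_le fun a => by
    simp only [henc, List.length_append, length_encodeTally]; omega
  have htime : PolyBound (fun a => (encα a).length) fun a =>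
      9 * B a + 9 * c a + M.time.eval (B a) + 27 :=
    ((((PolyBound.const 9).mul hB).add ((PolyBound.const 9).mul hc)).add (hB.eval M.time)).add
      (.const 27)
  refine polyTimeDecidable_exists (O := M.toTM2ComputableAux) (q := accept q) henc htime
    fun a x F => ?_
  let out := M.outputsFun (D a x)
  have hsteps : out.steps ≤ M.time.eval (B a) :=
    out.steps_le_m.trans (eval_mono_nat _ (hq a x F).1)
  have hlen := (hq a x F).1
  have hvalue := hf a x
  refine (tests_accept (fun F => (hq a x F).runsIn rfl) out.evals_in_steps F).weaken ?_ ?_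
  · simp
  · simp only [length_encodeTally]
    omega

section Expand

variable {α : Type} [Fintype α]

/-- A list of length `t` that contains every `v` with multiplicity `x v`, as long as there is room,
and is filled up with copies of `b`. -/
noncomputable def expand (t : ℕ) (b : α) (x : α → ℕ) : List α :=
  (Finset.univ.toList.flatMap (fun v => List.replicate (x v) v) ++ List.replicate (t + 1) b).take t

@[simp]
theorem length_expand (t : ℕ) (b : α) (x : α → ℕ) : (expand t b x).length = t := by
  simp only [expand, List.length_take, List.length_append, List.length_replicate]
  omega

theorem expand_count_perm [DecidableEq α] (b : α) (P : List α) :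
    (expand P.length b (P.count ·)).Perm P := by
  have hperm : (Finset.univ.toList.flatMap fun v => List.replicate (P.count v) v).Perm P :=
    List.perm_iff_count.mpr fun a => by
      simp [List.count_flatMap, Function.comp_def, List.count_replicate]
  have htake := List.take_left
    (l₁ := Finset.univ.toList.flatMap fun v => List.replicate (P.count v) v)
    (l₂ := List.replicate (P.length + 1) b)
  rw [hperm.length_eq] at htake
  exact (List.Perm.of_eq htake).trans hperm

end Expand

section Budget

variable {V : Type}

/-- Append the word `w` to the argument, unless the budget, which is kept on stack `fst`, is used
up. -/
def spend (w : List Γ') : Prog (Reg V) :=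
  .ite .fst Option.isSome (.seq (.pop .fst) (pushAll .arg w)) .skip

variable [DecidableEq V] {O : TM2ComputableAux Γ' Γ'} {S : Store (Reg V)} {p q : Prog (Reg V)}
  {ws ws' : List (List Γ')} {T T' : ℕ}

/-- The program `p` appends the words `ws` to the argument until the budget is used up. -/
def Spends (O : TM2ComputableAux Γ' Γ') (S : Store (Reg V)) (p : Prog (Reg V))
    (ws : List (List Γ')) (T : ℕ) : Prop :=
  ws.flatten.length ≤ T ∧ ∀ b l,
    RunsIn O p (update (update S .fst (List.replicate b one)) .arg l)
      (update (update S .fst (List.replicate (b - ws.length) one)) .arg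
        ((ws.take b).flatten.reverse ++ l)) T

theorem spends_spend (w : List Γ') : Spends O S (spend w) [w] (w.length + 3) := by
  refine ⟨by simp, fun b l => ?_⟩
  cases b with
  | zero => exact (RunsIn.ite_false (by simp) runsIn_skip).weaken (by simp) (by omega)
  | succ b =>
    refine (RunsIn.ite_true (by simp) ((runsIn_pop _).seq (runsIn_pushAll _ _ _))).weaken
      ?_ (by omega)
    simp [update_comm]

theorem Spends.mono (h : Spends O S p ws T) (hT : T ≤ T') : Spends O S p ws T' :=
  ⟨h.1.trans hT, fun b l => (h.2 b l).weaken rfl hT⟩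

theorem Spends.seq (h : Spends O S p ws T) (h' : Spends O S q ws' T') :
    Spends O S (.seq p q) (ws ++ ws') (T + T') := by
  refine ⟨by simpa using add_le_add h.1 h'.1,
    fun b l => ((h.2 b l).seq (h'.2 _ _)).weaken ?_ le_rfl⟩
  simp [List.take_append, Nat.sub_sub]

theorem spends_seqAll {α : Type} {p : α → Prog (Reg V)} {ws : α → List (List Γ')} (as : List α)
    (h : ∀ a ∈ as, Spends O S (p a) (ws a) T) :
    Spends O S (seqAll (as.map p)) (as.flatMap ws) (as.length * T + 1) := by
  induction as with
  | nil => exact ⟨by simp, fun b l => runsIn_skip.weaken (by simp) (by simp)⟩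
  | cons a as ih =>
    exact ((h a (by simp)).seq (ih fun b hb => h b (by simp [hb]))).mono
      (by rw [List.length_cons]; linarith)

theorem spends_forEach_spend {k : Reg V} (htmp : k ≠ .tmp) (hfst : k ≠ .fst) (harg : k ≠ .arg)
    (hS : S .tmp = []) (w : List Γ') :
    Spends O S (forEach k .tmp (spend w)) (List.replicate (S k).length w)
      ((S k).length * (w.length + 9) + 2) := by
  refine ⟨?_, fun b l => ?_⟩
  · simp only [List.length_flatten, List.map_replicate, List.sum_replicate, smul_eq_mul]
    linarith
  let stage (S : Store (Reg V)) (i : ℕ) : Store (Reg V) :=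
    update (update S .fst (List.replicate (b - i) one)) .arg
      (((List.replicate i w).take b).flatten.reverse ++ l)
  have hcomm : ∀ i u l', stage (update (update S k u) .tmp l') i =
      update (update (stage S i) k u) .tmp l' := fun i u l' => by
    simp [stage, update_comm htmp, update_comm hfst, update_comm harg, update_comm]
  have hloop := runsIn_forEach (O := O) (p := spend w) (w := S k) (T := w.length + 3) htmp
    (stage S) (by simp [stage, hfst, harg]) (by simp [stage, hS]) fun i _ l' => by
      have htake : (List.replicate (i + 1) w).take b =
          (List.replicate i w).take b ++ [w].take (b - i) := by
        rw [List.replicate_succ', List.take_append, List.length_replicate]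
      rw [← hcomm, ← hcomm]
      refine ((spends_spend w).2 (b - i) _).weaken ?_ le_rfl
      simp only [stage, htake, List.flatten_append, List.reverse_append, List.append_assoc,
        Nat.sub_sub, List.length_singleton]
  simpa [stage] using hloop

theorem Spends.appends {n : ℕ} (hbound : S .bound = List.replicate (n + 1) one)
    (hfst : S .fst = []) (htmp : S .tmp = []) (h : Spends O S p ws T) (hws : n ≤ ws.length) :
    Appends O S .arg (.seq (.seq (copy .bound .fst .tmp) (.pop .fst)) p) (ws.take n).flatten
      (7 * n + 10 + T) := by
  refine ⟨?_, fun l => ?_⟩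
  · have hle := (List.take_sublist n ws).flatten.length_le
    have hlen := h.1
    omega
  · have hfill : RunsIn O (.seq (copy .bound .fst .tmp) (.pop .fst)) (update S .arg l)
        (update (update S .fst (List.replicate n one)) .arg l) (7 * (n + 1) + 2 + 1) :=
      ((runsIn_copy (by simp) (by simp) (by simp) (by simp [htmp])).seq
        (runsIn_pop (.fst : Reg V))).weaken (by simp [hbound, hfst, update_comm])
          (by simp [hbound])
    have hS : update S .fst [] = S := update_eq_self_iff.mpr hfst.symm
    refine (hfill.seq (h.2 n l)).weaken ?_ (by omega)
    simp [Nat.sub_eq_zero_of_le hws, hS]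

/-- Append the words of the list `expand t b x`, where `x` are the counters and the bound is
`t + 1`. -/
noncomputable def appendExpand [Fintype V] (enc : V → List Γ') (b : V) : Prog (Reg V) :=
  .seq (.seq (copy .bound .fst .tmp) (.pop .fst))
    (.seq (seqAll (Finset.univ.toList.map fun v =>
      forEach (.counter v) .tmp (spend (enc v)))) (forEach .bound .tmp (spend (enc b))))

theorem appends_appendExpand [Fintype V] {enc : V → List Γ'} {b : V} {t C : ℕ} {I : Input}
    {x : V → ℕ} {F : Prop} (hC : ∀ v, (enc v).length ≤ C) (hI : I.bound = t + 1)
    (hx : ∀ v, x v ≤ t + 1) :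
    Appends O (I.store x F) .arg (appendExpand enc b) ((expand t b x).flatMap enc)
      (7 * t + 10 + ((Fintype.card V + 1) * ((t + 1) * (C + 9) + 2) + 1)) := by
  have hbound : (I.store x F .bound).length = t + 1 := by simp [Input.store, hI]
  have hcounter : ∀ v, (I.store x F (.counter v)).length = x v := by simp [Input.store]
  have hspend : ∀ k v, k ≠ .tmp → k ≠ .fst → k ≠ .arg → (I.store x F k).length ≤ t + 1 →
      Spends O (I.store x F) (forEach k .tmp (spend (enc v)))
        (List.replicate (I.store x F k).length (enc v)) ((t + 1) * (C + 9) + 2) :=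
    fun k v htmp hfst harg hk => (spends_forEach_spend htmp hfst harg rfl (enc v)).mono (by
      gcongr
      exact hC v)
  have hall := (spends_seqAll Finset.univ.toList fun v _ => hspend (.counter v) v (by simp)
    (by simp) (by simp) (by simpa [hcounter] using hx v)).seq (hspend .bound b (by simp)
      (by simp) (by simp) hbound.le)
  have happ := hall.appends (n := t) (by simp [Input.store, hI]) rfl rfl
    (by rw [List.length_append, List.length_replicate, hbound]; omega)
  simp only [hcounter, hbound, Finset.length_toList, Finset.card_univ] at happ
  rw [List.flatMap_def, expand, List.map_take, List.map_append, List.map_flatMap]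
  simp only [List.map_replicate]
  exact happ.mono (by linarith)

end Budget

section Distinct

variable {V : Type}

/-- Append the height of stack `k` to the argument, as a tally. -/
def writeTally (k : Reg V) : Prog (Reg V) := .seq (copy k .arg .tmp) (pushAll .arg [Γ'.comma])

/-- Mark the counter `v` as a duplicate if it has the same value as the counter `w`. -/
def markEq (v w : V) : Prog (Reg V) :=
  .seq (copy (.counter v) .fst .tmp) (.seq (copy (.counter w) .snd .tmp)
    (ifEqHeight .fst .snd .err (.push .dup one)))

/-- Append the value of the counter `v`, unless one of the counters `vs` has the same value. -/
def writeUnlessMem (v : V) (vs : List V) : Prog (Reg V) :=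
  .seq (seqAll (vs.map (markEq v)))
    (.ite .dup Option.isSome (clear .dup) (writeTally (.counter v)))

/-- Append the values of the counters `vs`, each value only at its last occurrence. -/
def writeDistinct : List V → Prog (Reg V)
  | [] => .skip
  | v :: vs => .seq (writeUnlessMem v vs) (writeDistinct vs)

variable [DecidableEq V] {O : TM2ComputableAux Γ' Γ'} {I : Input} {x : V → ℕ} {F : Prop} {N : ℕ}

theorem appends_writeTally {S : Store (Reg V)} {k : Reg V} {n : ℕ} (htmp : k ≠ .tmp)
    (harg : k ≠ .arg) (hS : S .tmp = []) (hk : S k = List.replicate n one) :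
    Appends O S .arg (writeTally k) (UpToL.encodeTally n) (7 * n + 4) := by
  have happ := (appends_copy (O := O) htmp harg (by simp) hS).seq (appends_pushAll [Γ'.comma])
  rw [hk] at happ
  exact happ.mono (by simp)

theorem appends_markEq (hx : ∀ v, x v ≤ N) (l : List Γ') (v w : V) :
    Appends O (update (I.store x F) .arg l) .dup (markEq v w) (if x v = x w then [one] else [])
      (22 * N + 10) := by
  refine ⟨by split <;> simp, fun d => ?_⟩
  let S := update (update (I.store x F) .arg l) .dup d
  have hv := runsIn_copy (O := O) (k := .counter v) (v := .fst) (tmp := .tmp) (S := S)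
    (by simp) (by simp) (by simp) rfl
  have hw := runsIn_copy (O := O) (k := .counter w) (v := .snd) (tmp := .tmp)
    (S := update S .fst (List.replicate (x v) one)) (by simp) (by simp) (by simp) rfl
  have hcompare := runsIn_ifEqHeight (O := O) (k := .fst) (k' := .snd) (e := .err)
    (S := update (update S .fst (List.replicate (x v) one)) .snd (List.replicate (x w) one))
    (by simp) (by simp) (by simp) rfl (runsIn_push .dup one)
  have hxv := hx v
  have hxw := hx w
  refine (RunsIn.seq (hv.weaken ?_ le_rfl) ((hw.weaken ?_ le_rfl).seq hcompare)).weaken ?_ ?_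
  · simp [S, Input.store]
  · simp [S, Input.store]
  · funext j
    by_cases h : x v = x w <;> cases j <;> simp [S, Input.store, h]
  · simp only [ne_eq, reduceCtorEq, not_false_eq_true, update_of_ne, Input.store,
      List.length_replicate, update_self, S]
    omega

theorem appends_writeUnlessMem (hx : ∀ v, x v ≤ N) (v : V) (vs : List V) :
    Appends O (I.store x F) .arg (writeUnlessMem v vs)
      (if x v ∈ vs.map x then [] else UpToL.encodeTally (x v))
      (vs.length * (66 * N + 30) + 7 * N + 6) := by
  have hxv := hx v
  refine ⟨by split <;> simp; omega, fun l => ?_⟩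
  obtain ⟨marks, hmarks, happ⟩ : ∃ marks, (marks = [] ↔ x v ∉ vs.map x) ∧
      Appends O (update (I.store x F) .arg l) .dup (seqAll (vs.map (markEq v))) marks
        (vs.length * (22 * N + 10) + 1) :=
    ⟨_, by simp [@eq_comm _ (x v)], appends_seqAll vs fun w _ => appends_markEq hx l v w⟩
  have hlen := happ.1
  have hmark := happ.runsIn rfl
  have hdup : update (update (I.store x F) .arg l) .dup [] = update (I.store x F) .arg l :=
    update_eq_self_iff.mpr rfl
  by_cases hmem : x v ∈ vs.map x
  · refine (hmark.seq (.ite_true ?_ (runsIn_clear _ _))).weaken ?_ ?_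
    · simpa [← List.isSome_head?] using hmarks.not_left.mpr hmem
    · rw [update_idem, hdup, if_pos hmem, List.reverse_nil, List.nil_append]
    · simp only [update_self, List.length_reverse]
      linarith
  · rw [hmarks.mpr hmem, List.reverse_nil, hdup] at hmark
    rw [if_neg hmem]
    have hmul := Nat.mul_le_mul_left vs.length (show 22 * N + 10 ≤ 66 * N + 30 by omega)
    exact (hmark.seq (.ite_false rfl
      ((appends_writeTally (by simp) (by simp) rfl rfl).2 l))).weaken rfl (by linarith)

theorem appends_writeDistinct (hx : ∀ v, x v ≤ N) {n : ℕ} {vs : List V} (hvs : vs.length ≤ n) :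
    Appends O (I.store x F) .arg (writeDistinct vs)
      ((vs.map x).dedup.flatMap UpToL.encodeTally)
      (vs.length * (n * (66 * N + 30) + 7 * N + 6) + 1) := by
  induction vs with
  | nil => exact ⟨by simp, fun l => runsIn_skip.weaken (by simp) (by simp)⟩
  | cons v vs ih =>
    have hle : vs.length ≤ n := (Nat.le_succ _).trans hvs
    have happ := ((appends_writeUnlessMem (O := O) (I := I) (F := F) hx v vs).mono
      (T' := n * (66 * N + 30) + 7 * N + 6) (by gcongr)).seq (ih hle)
    have hwords : ((v :: vs).map x).dedup.flatMap UpToL.encodeTally =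
        (if x v ∈ vs.map x then [] else UpToL.encodeTally (x v)) ++
          (vs.map x).dedup.flatMap UpToL.encodeTally := by
      rw [List.map_cons]
      split
      · rw [List.dedup_cons_of_mem ‹_›, List.nil_append]
      · rw [List.dedup_cons_of_notMem ‹_›, List.flatMap_cons]
    rw [hwords]
    exact happ.mono (by rw [List.length_cons]; linarith)

end Distinct

end StackProg

namespace UpToL

open Turing Computability Function StackProg

variable {m L : ℕ}

theorem length_encodeBallot_le (v : Ballot m L) : (encodeBallot v).length ≤ L * m + 2 := by
  have hsum : (v.ranking.map fun c : Fin m => (encodeTally c).length).sum ≤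
      v.ranking.length * m := by
    simpa using List.sum_le_card_nsmul (v.ranking.map fun c : Fin m => (encodeTally c).length) m
      (by simp [encodeTally])
  have hrank : v.ranking.length * m ≤ L * m := Nat.mul_le_mul_right m v.length_le
  simp only [encodeBallot, List.cons_append, List.length_cons, List.length_append,
    List.length_flatMap, List.length_nil]
  omega

instance : Finite (Ballot m L) :=
  .of_injective (fun v : Ballot m L => (⟨v.ranking, v.nodup⟩ : {l : List (Fin m) // l.Nodup}))
    fun _ _ h => Ballot.ext (congrArg Subtype.val h)

theorem nonempty_ballot (hm : 0 < m) (hL : 0 < L) : Nonempty (Ballot m L) :=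
  ⟨[⟨0, hm⟩], by simp, le_rfl, hL⟩

theorem exists_winner_expand_iff [Fintype (Ballot m L)] {r : VotingRule L} (hr : r.Anonymous)
    (hm : 0 < m) (b : Ballot m L) (P : Profile m L) (t : ℕ) (c : Fin m) :
    (∃ x : Ballot m L → Fin (t + 1), r m hm (P ++ expand t b fun v => x v) = c) ↔
      ∃ P' : Profile m L, P'.length = t ∧ r m hm (P ++ P') = c := by
  classical
  refine ⟨fun ⟨x, hx⟩ => ⟨_, length_expand t b _, hx⟩, ?_⟩
  rintro ⟨P', rfl, hP'⟩
  refine ⟨fun v => ⟨P'.count v, Nat.lt_succ_of_le List.count_le_length⟩, ?_⟩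
  exact (hr m hm _ _ ((expand_count_perm b P').append_left P)).trans hP'

/-- Append the election in which, next to the known votes, the absent votes are cast according to
the counters. -/
noncomputable def appendElection [Fintype (Ballot m L)] (b : Ballot m L) :
    Prog (Reg (Ballot m L)) :=
  .seq (.seq (pushAll .arg (encodeTally m)) (copy .inp .arg .tmp)) (appendExpand encodeBallot b)

theorem appends_appendElection [Fintype (Ballot m L)] [DecidableEq (Ballot m L)] (hm : 0 < m)
    (b : Ballot m L) :
    ∃ A B : ℕ, m ≤ A ∧ ∀ (O : TM2ComputableAux Γ' Γ') (P : Profile m L) (t c n : ℕ)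
      (x : Ballot m L → ℕ) (F : Prop), (∀ v, x v ≤ t + 1) → t + (encodeProfile P).length ≤ n →
      Appends O (Input.store ⟨encodeProfile P, t + 1, c⟩ x F) .arg (appendElection b)
        (encodeElection ⟨m, hm, P ++ expand t b x⟩) (A + B * n) := by
  refine ⟨m + 15 + (Fintype.card (Ballot m L) + 1) * (L * m + 13),
    7 + (Fintype.card (Ballot m L) + 1) * (L * m + 11), by omega, fun O P t c n x F hx hn => ?_⟩
  have happ := ((appends_pushAll (O := O)
    (S := Input.store ⟨encodeProfile P, t + 1, c⟩ x F) (encodeTally m)).seq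
      (appends_copy (v := .inp) (tmp := .tmp) (by simp) (by simp) (by simp) rfl)).seq
        (appends_appendExpand (b := b) length_encodeBallot_le rfl hx)
  have hwords : encodeElection ⟨m, hm, P ++ expand t b x⟩ =
      encodeTally m ++ encodeProfile P ++ (expand t b x).flatMap encodeBallot := by
    simp [encodeElection, encodeProfile]
  have hmul := Nat.mul_le_mul_left ((Fintype.card (Ballot m L) + 1) * (L * m + 11))
    (show t ≤ n by omega)
  rw [hwords]
  refine happ.mono ?_
  simp only [Input.store, length_encodeTally]
  linarith

open Classical in
theorem polyTimeDecidable_fixedM (hL : 0 < L) {r : VotingRule L} (hr : r.Anonymous)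
    (hpoly : r.PolyTime) (hm : 0 < m) :
    PolyTimeDecidable (encodeFixedM (L := L) (m := m)) fun I => r.WAV I.1 := by
  obtain ⟨M⟩ := hpoly
  obtain ⟨b⟩ := nonempty_ballot hm hL
  have := Fintype.ofFinite (Ballot m L)
  obtain ⟨A, B, hA, happ⟩ := appends_appendElection hm b
  let D (I : {I : WAVInstance L // I.m = m}) (x : Ballot m L → Fin (I.1.absent + 1)) : Election L :=
    ⟨m, hm, (I.2 ▸ I.1.known) ++ expand I.1.absent b fun v => x v⟩
  have hWAV : (fun I : {I : WAVInstance L // I.m = m} => r.WAV I.1) =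
      fun I => ∃ x, r.winner (D I x) = I.1.target := by
    funext ⟨I, hI⟩
    subst hI
    exact propext ((exists_winner_expand_iff hr hm b I.known I.absent I.target).symm.trans
      (by simp only [VotingRule.winner, D, Fin.val_inj]))
  rw [hWAV]
  refine polyTimeDecidable_exists_eq M D (w := fun I => encodeProfile I.1.known)
    (B := fun I => A + B * (encodeFixedM I).length) (q := appendElection b) (fun I => rfl)
    ((PolyBound.const A).add ((PolyBound.const B).mul (.of_le fun _ => le_rfl)))
    (fun I x => ?_) ?_
  · exact le_add_right ((r m hm _).2.le.trans hA)
  · rintro ⟨I, rfl⟩ x F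
    exact happ _ _ _ _ _ _ _ (fun v => (x v).2.le)
      (by simp only [encodeFixedM, List.length_append, length_encodeTally]; omega)

/-- The vote that ranks the distinct values of `y`, in the order of their last occurrences. -/
def ballotOfFn (hL : 0 < L) (y : Fin L → Fin m) : Ballot m L where
  ranking := (List.ofFn y).dedup
  nodup := List.nodup_dedup _
  one_le_length := by
    have hmem : y ⟨0, hL⟩ ∈ (List.ofFn y).dedup := List.mem_dedup.mpr (by simp)
    exact List.length_pos_of_mem hmem
  length_le := by simpa using (List.dedup_sublist (List.ofFn y)).length_le

theorem dedup_replicate_append {α : Type*} [DecidableEq α] {a : α} {l : List α} (ha : a ∈ l)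
    (hl : l.Nodup) (n : ℕ) : (List.replicate n a ++ l).dedup = l := by
  induction n with
  | zero => exact hl.dedup
  | succ n ih =>
    rw [List.replicate_succ, List.cons_append,
      List.dedup_cons_of_mem (List.mem_append_right _ ha), ih]

theorem ballotOfFn_surjective (hL : 0 < L) :
    Surjective (ballotOfFn hL : (Fin L → Fin m) → Ballot m L) := by
  intro v
  obtain ⟨a, ha⟩ := List.exists_mem_of_length_pos v.one_le_length
  let l := List.replicate (L - v.ranking.length) a ++ v.ranking
  have hlen : l.length = L := by simp [l, v.length_le]
  refine ⟨fun i => l.get (i.cast hlen.symm), Ballot.ext ?_⟩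
  have hofFn : List.ofFn (fun i => l.get (i.cast hlen.symm)) = l :=
    List.ext_getElem (by simp [hlen]) (by simp)
  exact (congrArg List.dedup hofFn).trans (dedup_replicate_append ha v.nodup _)

/-- The absent votes that are described by `t` rows of `L` candidates. -/
def absentVotes {t : ℕ} (hL : 0 < L) (y : Fin t × Fin L → Fin m) : Profile m L :=
  List.ofFn fun j => ballotOfFn hL fun i => y (j, i)

theorem exists_absentVotes_eq_iff {t : ℕ} (hL : 0 < L) {P : Profile m L} :
    (∃ y : Fin t × Fin L → Fin m, absentVotes hL y = P) ↔ P.length = t := by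
  constructor
  · rintro ⟨y, rfl⟩
    simp [absentVotes]
  · rintro rfl
    choose y hy using fun j => ballotOfFn_surjective hL (P.get j)
    exact ⟨fun v => y v.1 v.2, by simp only [absentVotes, hy, List.ofFn_get]⟩

/-- Append the ballot of the absent voter `j`. -/
def writeBallot {t : ℕ} (L : ℕ) (j : Fin t) : Prog (Reg (Fin t × Fin L)) :=
  .seq (.seq (pushAll .arg [Γ'.bra]) (writeDistinct (List.ofFn fun i => (j, i))))
    (pushAll .arg [Γ'.ket])

/-- Append the election in which, next to the known votes, the `t` absent votes described by the
counters are cast. -/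
def writeElection (L t : ℕ) : Prog (Reg (Fin t × Fin L)) :=
  .seq (.seq (writeTally .bound) (copy .inp .arg .tmp))
    (seqAll ((List.finRange t).map (writeBallot L)))

section

variable {O : TM2ComputableAux Γ' Γ'} {t : ℕ} {I : Input} {F : Prop}

theorem appends_writeBallot (hL : 0 < L) (y : Fin t × Fin L → Fin m) (j : Fin t) :
    Appends O (I.store (fun v => y v) F) .arg (writeBallot L j)
      (encodeBallot (ballotOfFn hL fun i => y (j, i)))
      (L * (L * (66 * m + 30) + 7 * m + 6) + 5) := by
  have happ := ((appends_pushAll [Γ'.bra]).seq (appends_writeDistinct (O := O) (I := I) (F := F)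
    (x := fun v => y v) (fun v => (y v).2.le) (vs := List.ofFn fun i => (j, i))
    (List.length_ofFn).le)).seq (appends_pushAll [Γ'.ket])
  have hwords : ((List.ofFn fun i => (j, i)).map fun v => (y v : ℕ)).dedup =
      (List.ofFn fun i => y (j, i)).dedup.map Fin.val := by
    rw [← List.dedup_map_of_injective Fin.val_injective]
    simp [Function.comp_def]
  rw [hwords, List.flatMap_map, List.length_ofFn] at happ
  exact happ.mono (by simp only [List.length_singleton]; omega)

theorem appends_writeElection (hL : 0 < L) (hm : 0 < m) {P : Profile m L} {c n : ℕ}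
    (y : Fin t × Fin L → Fin m) (hn : m + (encodeProfile P).length ≤ n) :
    Appends O (Input.store ⟨encodeProfile P, m, c⟩ (fun v => y v) F) .arg (writeElection L t)
      (encodeElection ⟨m, hm, P ++ absentVotes hL y⟩)
      (7 + t * (L * (30 * L + 6) + 5) + (7 + t * (L * (66 * L + 7))) * n) := by
  have happ := ((appends_writeTally (O := O) (k := .bound) (n := m)
    (S := Input.store ⟨encodeProfile P, m, c⟩ (fun v => y v) F)
    (by simp) (by simp) rfl rfl).seq
      (appends_copy (v := .inp) (tmp := .tmp) (by simp) (by simp) (by simp) rfl)).seq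
        (appends_seqAll (List.finRange t) fun j _ => appends_writeBallot hL y j)
  have hwords : encodeElection ⟨m, hm, P ++ absentVotes hL y⟩ =
      encodeTally m ++ encodeProfile P ++
        (List.finRange t).flatMap fun j => encodeBallot (ballotOfFn hL fun i => y (j, i)) := by
    simp [encodeElection, encodeProfile, absentVotes, List.ofFn_eq_map, List.flatMap_map]
  have hmul := Nat.mul_le_mul_left (t * (L * (66 * L + 7))) (show m ≤ n by omega)
  rw [hwords]
  refine happ.mono ?_
  simp only [Input.store, List.length_finRange]
  linarith

end

theorem polyTimeDecidable_fixedT (hL : 0 < L) {r : VotingRule L} (hpoly : r.PolyTime) (t : ℕ) :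
    PolyTimeDecidable (encodeFixedT (L := L) (t := t)) fun I => r.WAV I.1 := by
  obtain ⟨M⟩ := hpoly
  let D (I : {I : WAVInstance L // I.absent = t}) (y : Fin t × Fin L → Fin I.1.m) : Election L :=
    ⟨I.1.m, I.1.target.pos, I.1.known ++ absentVotes hL y⟩
  have hWAV : (fun I : {I : WAVInstance L // I.absent = t} => r.WAV I.1) =
      fun I => ∃ y, r.winner (D I y) = I.1.target := by
    funext ⟨I, hI⟩
    simp only [VotingRule.WAV, hI, ← exists_absentVotes_eq_iff hL, exists_exists_eq_and,
      VotingRule.winner, D, Fin.val_inj]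
  rw [hWAV]
  refine polyTimeDecidable_exists_eq M D (k := 0) (w := fun I => encodeProfile I.1.known)
    (q := writeElection L t) (fun I => rfl)
    ((PolyBound.const (7 + t * (L * (30 * L + 6) + 5))).add
      ((PolyBound.const (7 + t * (L * (66 * L + 7)))).mul (.of_le fun _ => le_rfl)))
    (fun I y => ?_) fun I y F => ?_
  · have hwinner : r.winner (D I y) < I.1.m := (r _ _ _).2
    have hm : I.1.m ≤ (encodeFixedT I).length := by
      simp only [encodeFixedT, List.length_append, length_encodeTally]
      omega
    linarith [Nat.zero_le (t * (L * (66 * L + 7)) * (encodeFixedT I).length),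
      Nat.zero_le (t * (L * (30 * L + 6) + 5))]
  · exact appends_writeElection hL I.1.target.pos y
      (by simp only [encodeFixedT, List.length_append, length_encodeTally]; omega)

end UpToL

theorem proposition2_general (L : ℕ) (hL : 0 < L) (r : UpToL.VotingRule L) (hpoly : r.PolyTime) :
    (r.Anonymous → ∀ m : ℕ, 0 < m →
      UpToL.PolyTimeDecidable (UpToL.encodeFixedM (L := L) (m := m)) (fun I => r.WAV I.1)) ∧
    (∀ t : ℕ,
      UpToL.PolyTimeDecidable (UpToL.encodeFixedT (L := L) (t := t)) (fun I => r.WAV I.1)) :=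
  ⟨fun hanon _ hm => UpToL.polyTimeDecidable_fixedM hL hanon hpoly hm,
    UpToL.polyTimeDecidable_fixedT hL hpoly⟩

theorem proposition2 (L : ℕ) (hL : 2 ≤ L) (r : UpToL.VotingRule L)
    (hanon : r.Anonymous) (hpoly : r.PolyTime) :
    (∀ m : ℕ, 2 ≤ m →
      UpToL.PolyTimeDecidable (UpToL.encodeFixedM (L := L) (m := m)) (fun I => r.WAV I.1)) ∧
    (∀ t : ℕ,
      UpToL.PolyTimeDecidable (UpToL.encodeFixedT (L := L) (t := t)) (fun I => r.WAV I.1)) :=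
  (proposition2_general L (Nat.zero_lt_of_lt hL) r hpoly).imp
    (fun h m hm => h hanon m (Nat.zero_lt_of_lt hm)) id
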